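/- Let $\mathcal S,\mathcal A$ be finite nonempty sets, let $\Pi=\{\pi\in[0,1]^{\mathcal S\times\mathcal A}:\sum_a\pi(a|s)=1\ \forall s\}$ be the set of policies, let $\mathcal P=\{p\in[0,1]^{\mathcal S\times\mathcal A\times\mathcal S}:\sum_{s'}p(s'|s,a)=1\ \forall s,a\}$ be the set of transition kernels, and let all vectors carry the Euclidean norm $\|\cdot\|$. For every $\pi\in\Pi$ let a transition kernel $p_\pi\in\mathcal P$ and a reward $r_\pi\in[0,1]^{\mathcal S\times\mathcal A}$ be given; let $\rho$ be a probability distribution on $\mathcal S$, $\gamma\in(0,1)$ and $\lambda\ge0$. Write $\mathbb P_{\pi,p,\rho}$, $\mathbb E_{\pi,p,\rho}$ for the law of, and the expectation over, trajectories with $s_0\sim\rho$, $a_t\sim\pi(\cdot|s_t)$, $s_{t+1}\sim p(\cdot|s_t,a_t)$, and put $$d_{\pi,p}(s)=(1-\gamma)\sum_{a}\sum_{t\ge0}\gamma^t\,\mathbb P_{\pi,p,\rho}\{s_t=s,a_t=a\},\qquad V_{\lambda,\pi'}^{\pi}=\mathbb E_{\pi,p_{\pi'},\rho}\Big[\sum_{t\ge0}\gamma^t\big(r_{\pi'}(s_t,a_t)-\lambda\log\pi(a_t|s_t)\big)\Big].$$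 Gradients with respect to $\pi$ are taken within $\Pi$. For $\epsilon\ge0$, a policy $\pi\in\Pi$ is called $\epsilon$-performatively optimal ($\epsilon$-PO) if $\max_{\pi'\in\Pi}V_{\lambda,\pi'}^{\pi'}-V_{\lambda,\pi}^{\pi}\le\epsilon$, and performatively optimal (PO) if it is $0$-PO; it is called $\epsilon$-stationary if $\pi'\mapsto V_{\lambda,\pi'}^{\pi'}$ is differentiable at $\pi$ within $\Pi$ and $\max_{\tilde\pi\in\Pi}\langle\nabla_\pi V_{\lambda,\pi}^{\pi},\tilde\pi-\pi\rangle\le\epsilon$. Let $\epsilon_p,\epsilon_r,S_p,S_r,D>0$ be constants such that: 1. (Sensitivity) $\|p_{\pi'}-p_\pi\|\le\epsilon_p\|\pi'-\pi\|$ and $\|r_{\pi'}-r_\pi\|\le\epsilon_r\|\pi'-\pi\|$ for all $\pi,\pi'\in\Pi$. 2. (Smoothness) For all $s,s'\in\mathcal S$ and $a\in\mathcal A$, the functions $\pi\mapsto p_\pi(s'|s,a)$ and $\pi\mapsto r_\pi(s,a)$ are differentiable on $\Pi$, with $\|\nabla_\pi p_{\pi'}(s'|s,a)-\nabla_\pi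 p_\pi(s'|s,a)\|\le S_p\|\pi'-\pi\|$ and $\|\nabla_\pi r_{\pi'}(s,a)-\nabla_\pi r_\pi(s,a)\|\le S_r\|\pi'-\pi\|$ for all $\pi,\pi'\in\Pi$. 3. $d_{\pi,p}(s)\ge D$ for all $\pi\in\Pi$, $p\in\mathcal P$ and $s\in\mathcal S$. Put $$\mu=\frac{D\lambda}{1-\gamma}-\frac{6\gamma|\mathcal S|(1+\lambda\log|\mathcal A|)}{D(1-\gamma)^3}\Big[\epsilon_p\big(\sqrt{|\mathcal A|}+\gamma\epsilon_p\sqrt{|\mathcal S|}\big)+S_p(1-\gamma)\Big]-\frac{S_r(1-\gamma)+4\epsilon_r\big(\sqrt{|\mathcal A|}+\epsilon_p\sqrt{|\mathcal S|}\big)}{D^2(1-\gamma)^2}.$$ Then for every $\epsilon\ge0$, every $D\epsilon$-stationary policy is $(\epsilon+|\mu||\mathcal S|)$-PO, and it is $\epsilon$-PO if $\mu\ge0$. If $\mu>0$, there is exactly one PO policy. -/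

import Mathlib

open MeasureTheory ProbabilityTheory

noncomputable section

namespace PerformativeRL

/-- Vectors with entries `π (s, a)`, under the Euclidean norm (policies and rewards). -/
abbrev PolicyVec (S A : Type*) := EuclideanSpace ℝ (S × A)

/-- Vectors with entries `p (s, a, s')`, under the Euclidean norm (transition kernels);
`p (s, a, s')` is the probability `p(s' | s, a)`. -/
abbrev KernelVec (S A : Type*) := EuclideanSpace ℝ (S × A × S)

/-- The policy space `Π`: every `π(· | s)` is a probability distribution on the actions. -/
def policySpace (S A : Type*) [Fintype A] : Set (PolicyVec S A) :=
  {π | ∀ s, (fun a => π (s, a)) ∈ stdSimplex ℝ A}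

/-- The transition kernel space `𝒫`: every `p(· | s, a)` is a probability distribution. -/
def kernelSpace (S A : Type*) [Fintype S] : Set (KernelVec S A) :=
  {p | ∀ s a, (fun s' => p (s, a, s')) ∈ stdSimplex ℝ S}

/-- The reward space `[0, 1]^{S × A}`. -/
def rewardSpace (S A : Type*) : Set (PolicyVec S A) :=
  {r | ∀ x, 0 ≤ r x ∧ r x ≤ 1}

section Trajectory

/-- The probability mass function with weights `w`, if `w` is a probability vector
(otherwise an irrelevant default). -/
def pmfOfVec {X : Type*} [Fintype X] [Nonempty X] (w : X → ℝ) : PMF X :=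
  open Classical in
  if h : w ∈ stdSimplex ℝ X then
    PMF.ofFintype (fun x => ENNReal.ofReal (w x)) (by
      rw [← ENNReal.ofReal_sum_of_nonneg (fun x _ => h.1 x), h.2, ENNReal.ofReal_one])
  else PMF.pure (Classical.arbitrary X)

variable {S A : Type*} [Fintype S] [Fintype A] [Nonempty S] [Nonempty A]

/-- The law of `(s, a)` where `s ∼ w` and then `a ∼ π(· | s)`. -/
def stateActionLaw (π : PolicyVec S A) (w : S → ℝ) : PMF (S × A) :=
  (pmfOfVec w).bind fun s => (pmfOfVec fun a => π (s, a)).map fun a => (s, a)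

variable [MeasurableSpace S] [DiscreteMeasurableSpace S]
  [MeasurableSpace A] [DiscreteMeasurableSpace A]

/-- The one-step kernel: from `(s_n, a_n)` (the last entry of the history up to time `n`) the
process moves to `(s_{n+1}, a_{n+1})` with `s_{n+1} ∼ p(· | s_n, a_n)` and
`a_{n+1} ∼ π(· | s_{n+1})`. -/
def stepKernel (π : PolicyVec S A) (p : KernelVec S A) (n : ℕ) :
    Kernel (∀ _ : Finset.Iic n, S × A) (S × A) where
  toFun h := (stateActionLaw π fun s' =>
    p ((h ⟨n, Finset.mem_Iic.2 le_rfl⟩).1, (h ⟨n, Finset.mem_Iic.2 le_rfl⟩).2, s')).toMeasure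
  measurable' := (Measurable.of_discrete (f := fun x : S × A =>
    (stateActionLaw π fun s' => p (x.1, x.2, s')).toMeasure)).comp (measurable_pi_apply _)

instance (π : PolicyVec S A) (p : KernelVec S A) (n : ℕ) : IsMarkovKernel (stepKernel π p n) :=
  ⟨fun _ => PMF.toMeasure.isProbabilityMeasure _⟩

/-- The law `ℙ_{π, p, ρ}` of the trajectory `(s_0, a_0), (s_1, a_1), …` that starts with `s_0 ∼ ρ`,
`a_0 ∼ π(· | s_0)`. -/
def trajLaw (π : PolicyVec S A) (p : KernelVec S A) (ρ : S → ℝ) : Measure (ℕ → S × A) :=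
  Kernel.trajMeasure (X := fun _ => S × A) (stateActionLaw π ρ).toMeasure (stepKernel π p)

/-- The state occupancy measure
`d_{π, p}(s) = ∑_a d_{π, p}(s, a)`,
`d_{π, p}(s, a) = (1 - γ) ∑_t γ^t ℙ_{π, p, ρ}(s_t = s, a_t = a)`. -/
def stateOccupancy (γ : ℝ) (ρ : S → ℝ) (π : PolicyVec S A) (p : KernelVec S A) (s : S) : ℝ :=
  ∑ a, (1 - γ) * ∑' t : ℕ, γ ^ t * (trajLaw π p ρ).real {ω | ω t = (s, a)}

/-- `𝔼_{π, p, ρ} [∑_t γ^t (r(s_t, a_t) - lam * log π(a_t | s_t))]`. -/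
def regValue (γ lam : ℝ) (ρ : S → ℝ) (π : PolicyVec S A) (p : KernelVec S A)
    (r : PolicyVec S A) : ℝ :=
  ∫ ω, ∑' t : ℕ, γ ^ t * (r (ω t) - lam * Real.log (π (ω t))) ∂(trajLaw π p ρ)

end Trajectory

/-- An entropy-regularized performative reinforcement learning problem with finite state space `S`
and action space `A`: policy-dependent transition kernels `p_π` and rewards `r_π` (only their
values at policies `π ∈ Π` matter), initial distribution `ρ`, discount factor `γ ∈ (0, 1)` and
regularization coefficient `lam ≥ 0`. -/
structure PerformativeMDP (S A : Type*) [Fintype S] [Fintype A] where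
  p : PolicyVec S A → KernelVec S A
  r : PolicyVec S A → PolicyVec S A
  ρ : S → ℝ
  γ : ℝ
  lam : ℝ
  p_mem : ∀ π ∈ policySpace S A, p π ∈ kernelSpace S A
  r_mem : ∀ π ∈ policySpace S A, r π ∈ rewardSpace S A
  ρ_mem : ρ ∈ stdSimplex ℝ S
  γ_pos : 0 < γ
  γ_lt_one : γ < 1
  lam_nonneg : 0 ≤ lam

namespace PerformativeMDP

variable {S A : Type*} [Fintype S] [Fintype A]

/-- Sensitivity: `π ↦ p_π` and `π ↦ r_π` are Lipschitz on `Π`. -/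
def Sensitive (M : PerformativeMDP S A) (εp εr : ℝ) : Prop :=
  ∀ π ∈ policySpace S A, ∀ π' ∈ policySpace S A,
    ‖M.p π' - M.p π‖ ≤ εp * ‖π' - π‖ ∧ ‖M.r π' - M.r π‖ ≤ εr * ‖π' - π‖

/-- `f` is differentiable on `Π` with an `L`-Lipschitz gradient. Gradients are taken within `Π`,
where alone `f` is given. -/
def LipschitzSmooth (f : PolicyVec S A → ℝ) (L : ℝ) : Prop :=
  ∃ g : PolicyVec S A → PolicyVec S A,
    (∀ π ∈ policySpace S A, HasGradientWithinAt f (g π) (policySpace S A) π) ∧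
    ∀ π ∈ policySpace S A, ∀ π' ∈ policySpace S A, ‖g π' - g π‖ ≤ L * ‖π' - π‖

/-- Smoothness: every entry of `p_π` and of `r_π` is Lipschitz smooth in `π`. -/
def Smooth (M : PerformativeMDP S A) (Sp Sr : ℝ) : Prop :=
  (∀ s a s', LipschitzSmooth (fun π => M.p π (s, a, s')) Sp) ∧
  ∀ s a, LipschitzSmooth (fun π => M.r π (s, a)) Sr

/-- The constant `μ`. -/
def mu (M : PerformativeMDP S A) (εp εr Sp Sr D : ℝ) : ℝ :=
  let nS : ℝ := Fintype.card S
  let nA : ℝ := Fintype.card A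
  D * M.lam / (1 - M.γ)
    - 6 * M.γ * nS * (1 + M.lam * Real.log nA) / (D * (1 - M.γ) ^ 3)
      * (εp * (√nA + M.γ * εp * √nS) + Sp * (1 - M.γ))
    - (Sr * (1 - M.γ) + 4 * εr * (√nA + εp * √nS)) / (D ^ 2 * (1 - M.γ) ^ 2)

variable [Nonempty S] [Nonempty A] [MeasurableSpace S] [DiscreteMeasurableSpace S]
  [MeasurableSpace A] [DiscreteMeasurableSpace A]

/-- Every state has occupancy at least `D`, under all policies and all transition kernels. -/
def OccupancyBound (M : PerformativeMDP S A) (D : ℝ) : Prop :=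
  ∀ π ∈ policySpace S A, ∀ p ∈ kernelSpace S A, ∀ s, D ≤ stateOccupancy M.γ M.ρ π p s

/-- The value `V_{λ, π'}^π` of the policy `π` in the environment `(p_{π'}, r_{π'})`. -/
def value (M : PerformativeMDP S A) (π' π : PolicyVec S A) : ℝ :=
  regValue M.γ M.lam M.ρ π (M.p π') (M.r π')

/-- The performative value function `π ↦ V_{λ, π}^π`. -/
def perfValue (M : PerformativeMDP S A) (π : PolicyVec S A) : ℝ :=
  M.value π π

/-- `π` is `ε`-performatively optimal: `max_{π' ∈ Π} V_{λ, π'}^{π'} - V_{λ, π}^π ≤ ε`. -/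
def IsPO (M : PerformativeMDP S A) (ε : ℝ) (π : PolicyVec S A) : Prop :=
  π ∈ policySpace S A ∧
    ∃ m, IsGreatest (M.perfValue '' policySpace S A) m ∧ m - M.perfValue π ≤ ε

/-- `π` is `ε`-stationary: the performative value function has a gradient within `Π` at `π`, and
`max_{π' ∈ Π} ⟨∇_π V_{λ, π}^π, π' - π⟩ ≤ ε`. (Inner products of the gradient with `π' - π` do not
depend on the choice of a gradient within `Π`.) -/
def IsStationary (M : PerformativeMDP S A) (ε : ℝ) (π : PolicyVec S A) : Prop :=
  π ∈ policySpace S A ∧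
    ∃ g, HasGradientWithinAt M.perfValue g (policySpace S A) π ∧
      ∀ π' ∈ policySpace S A, inner ℝ g (π' - π) ≤ ε

end PerformativeMDP

end PerformativeRL

end

/-! Multiplied by `1 - γ`, the value of a policy is the average of its regularized reward over its
occupancy measure. In a fixed environment the occupancy measures form a convex set on which this
objective is concave. Two policies `π₀`, `π₁` are therefore joined not by a segment but by the curve
`mixPath`, whose point at time `α` is the policy of the mixture of the two occupancy measures with
weights `1 - α` and `α`.

In a fixed environment the value along this curve would exceed the linear interpolation of the end
values, with a quadratic surplus from the strong convexity of `x log x`. Here the two end policies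
and the policy on the curve have different environments, so the mixture need not be the occupancy
measure of its policy. `mixture_value_gap` is the exact identity for the resulting gap: an entropy
surplus, plus the shifts of the rewards, plus the shifts of the transition kernels tested against
the state values.

Divide by `α` and let `α → 0`. Each shift becomes a derivative at `π₀` minus a finite difference
between `π₁` and `π₀`. Their first-order parts cancel up to an error quadratic in `‖π₁ - π₀‖`: the
occupancy measures differ by a multiple of this norm, the initial velocity differs from `π₁ - π₀` by
a multiple of its square, and Taylor remainders are quadratic by smoothness. The result
(`exists_first_order_lower_bound`) is that the difference quotients of the performative value along
the curve dominate a function whose limit is at least `V(π₁) - V(π₀) + μ/2 * ‖π₁ - π₀‖ ^ 2`.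

At a `D * ε`-stationary `π₀`, the velocity scaled by `D` is a feasible direction, so the derivative
along the curve is at most `ε`; the bound `‖π₁ - π₀‖ ^ 2 ≤ 2|S|` then gives the optimality claims.
At a performatively optimal `π₀` the quotients are nonpositive, which forces uniqueness when `μ >
0`. Existence is compactness and continuity. -/

noncomputable section

namespace PerformativeRL

/-! ### Visit probabilities, occupancy measures and their flow equation. -/

section Trajectory

variable {S A : Type*} [Fintype S] [Fintype A] [Nonempty S] [Nonempty A]

lemma pmfOfVec_apply {X : Type*} [Fintype X] [Nonempty X] {w : X → ℝ} (hw : w ∈ stdSimplex ℝ X)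
    (x : X) : pmfOfVec w x = ENNReal.ofReal (w x) := by
  simp [pmfOfVec, hw]

lemma stateActionLaw_apply {π : PolicyVec S A} {w : S → ℝ} (hπ : π ∈ policySpace S A)
    (hw : w ∈ stdSimplex ℝ S) (x : S × A) :
    stateActionLaw π w x = ENNReal.ofReal (w x.1 * π x) := by
  classical
  obtain ⟨s, a⟩ := x
  rw [stateActionLaw, PMF.bind_apply, tsum_fintype, Finset.sum_eq_single s]
  · rw [PMF.map_apply, tsum_fintype, Finset.sum_eq_single a]
    · simp [pmfOfVec_apply hw, pmfOfVec_apply (hπ s), ENNReal.ofReal_mul (hw.1 s)]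
    · intro b _ hb
      simp [Ne.symm hb]
    · simp
  · intro b _ hb
    rw [PMF.map_apply]
    simp [Ne.symm hb]
  · simp

variable [MeasurableSpace S] [DiscreteMeasurableSpace S]
  [MeasurableSpace A] [DiscreteMeasurableSpace A]

lemma stateActionLaw_real {π : PolicyVec S A} {w : S → ℝ} (hπ : π ∈ policySpace S A)
    (hw : w ∈ stdSimplex ℝ S) (x : S × A) :
    (stateActionLaw π w).toMeasure.real {x} = w x.1 * π x := by
  rw [measureReal_def, PMF.toMeasure_apply_singleton _ _ (measurableSet_singleton x),
    stateActionLaw_apply hπ hw, ENNReal.toReal_ofReal (mul_nonneg (hw.1 _) ((hπ x.1).1 x.2))]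

instance (π : PolicyVec S A) (p : KernelVec S A) (ρ : S → ℝ) :
    IsProbabilityMeasure (trajLaw π p ρ) := by
  unfold trajLaw; infer_instance

/-- The probability that the trajectory visits the state-action pair `x` at time `t`. -/
def visitProb (ρ : S → ℝ) (π : PolicyVec S A) (p : KernelVec S A) (t : ℕ) (x : S × A) : ℝ :=
  (trajLaw π p ρ).real {ω | ω t = x}

lemma trajLaw_map_zero (π : PolicyVec S A) (p : KernelVec S A) (ρ : S → ℝ) :
    (trajLaw π p ρ).map (fun ω => ω 0) = (stateActionLaw π ρ).toMeasure := by
  have h : (trajLaw π p ρ).map (Preorder.frestrictLe 0) =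
      (stateActionLaw π ρ).toMeasure.map (MeasurableEquiv.piUnique _).symm := by
    rw [trajLaw, Kernel.trajMeasure, Measure.map_comp _ _ (by fun_prop),
      Kernel.traj_map_frestrictLe, Kernel.partialTraj_self, Measure.id_comp]
  have h2 : (fun ω : ℕ → S × A => ω 0) =
      (fun h : (∀ _ : Finset.Iic 0, S × A) => h ⟨0, Finset.mem_Iic.2 le_rfl⟩) ∘
        (Preorder.frestrictLe 0) := rfl
  rw [h2, ← Measure.map_map (measurable_pi_apply _) (by fun_prop), h,
    Measure.map_map (measurable_pi_apply _) (MeasurableEquiv.measurable _)]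
  exact Measure.map_id

lemma visitProb_zero {ρ : S → ℝ} {π : PolicyVec S A} {p : KernelVec S A}
    (hπ : π ∈ policySpace S A) (hρ : ρ ∈ stdSimplex ℝ S) (x : S × A) :
    visitProb ρ π p 0 x = ρ x.1 * π x := by
  rw [← stateActionLaw_real hπ hρ, ← trajLaw_map_zero π p ρ,
    map_measureReal_apply (measurable_pi_apply 0) (measurableSet_singleton x)]
  rfl

lemma integral_comp_eval (π : PolicyVec S A) (p : KernelVec S A) (ρ : S → ℝ) (t : ℕ)
    (f : S × A → ℝ) :
    ∫ ω, f (ω t) ∂(trajLaw π p ρ) = ∑ x, visitProb ρ π p t x * f x := by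
  have h : ∫ ω, f (ω t) ∂(trajLaw π p ρ) =
      ∫ x, f x ∂((trajLaw π p ρ).map (fun ω => ω t)) :=
    (integral_map (measurable_pi_apply t).aemeasurable
      (Measurable.of_discrete.aestronglyMeasurable)).symm
  have : IsProbabilityMeasure ((trajLaw π p ρ).map (fun ω => ω t)) :=
    Measure.isProbabilityMeasure_map (measurable_pi_apply t).aemeasurable
  rw [h, integral_fintype (Integrable.of_finite)]
  refine Finset.sum_congr rfl fun x _ => ?_
  rw [map_measureReal_apply (measurable_pi_apply t) (measurableSet_singleton x), smul_eq_mul]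
  rfl

lemma visitProb_succ {ρ : S → ℝ} {π : PolicyVec S A} {p : KernelVec S A}
    (hπ : π ∈ policySpace S A) (hp : p ∈ kernelSpace S A) (t : ℕ) (y : S × A) :
    visitProb ρ π p (t + 1) y =
      (∑ x : S × A, visitProb ρ π p t x * p (x.1, x.2, y.1)) * π y := by
  -- The law of the history together with the next pair is the composition product with
  -- `stepKernel`, which reads only the last entry of the history. This is the Markov property,
  -- reduced below to an integral of a function of `ω t`.
  have h := Kernel.map_frestrictLe_trajMeasure_compProd_eq_map_trajMeasure
    (X := fun _ => S × A) (μ₀ := (stateActionLaw π ρ).toMeasure) (κ := stepKernel π p) (a := t)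
  have hm : Measurable (fun ω : ℕ → S × A => (Preorder.frestrictLe (π := fun _ => S × A) t ω,
      ω (t + 1))) := by fun_prop
  have h1 : (trajLaw π p ρ) {ω | ω (t + 1) = y} =
      ∫⁻ ω, (stateActionLaw π fun s' => p ((ω t).1, (ω t).2, s')).toMeasure {y}
        ∂(trajLaw π p ρ) := by
    have h2 : (trajLaw π p ρ) {ω | ω (t + 1) = y} =
        ((trajLaw π p ρ).map (fun ω : ℕ → S × A =>
          (Preorder.frestrictLe (π := fun _ => S × A) t ω, ω (t + 1)))) (Set.univ ×ˢ {y}) := by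
      rw [Measure.map_apply hm (MeasurableSet.univ.prod (measurableSet_singleton y))]
      congr 1
      ext ω
      simp
    rw [h2, trajLaw, ← h, Measure.compProd_apply_prod MeasurableSet.univ
      (measurableSet_singleton y), Measure.restrict_univ, lintegral_map
      (Kernel.measurable_coe _ (measurableSet_singleton y)) (by fun_prop)]
    rfl
  have h3 : visitProb ρ π p (t + 1) y =
      ∫ ω, (stateActionLaw π fun s' => p ((ω t).1, (ω t).2, s')).toMeasure.real {y}
        ∂(trajLaw π p ρ) := by
    rw [visitProb, measureReal_def, h1, ← integral_toReal]
    · rfl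
    · exact ((Measurable.of_discrete (f := fun x : S × A =>
        (stateActionLaw π fun s' => p (x.1, x.2, s')).toMeasure {y})).comp
          (measurable_pi_apply t)).aemeasurable
    · exact Filter.Eventually.of_forall fun ω => measure_lt_top _ _
  rw [h3, integral_comp_eval π p ρ t
    (fun x => (stateActionLaw π fun s' => p (x.1, x.2, s')).toMeasure.real {y}), Finset.sum_mul]
  refine Finset.sum_congr rfl fun x _ => ?_
  rw [stateActionLaw_real hπ (hp x.1 x.2)]
  ring

lemma visitProb_nonneg (ρ : S → ℝ) (π : PolicyVec S A) (p : KernelVec S A) (t : ℕ) (x : S × A) :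
    0 ≤ visitProb ρ π p t x := measureReal_nonneg

lemma visitProb_le_one (ρ : S → ℝ) (π : PolicyVec S A) (p : KernelVec S A) (t : ℕ) (x : S × A) :
    visitProb ρ π p t x ≤ 1 := measureReal_le_one

lemma sum_visitProb (ρ : S → ℝ) (π : PolicyVec S A) (p : KernelVec S A) (t : ℕ) :
    ∑ x, visitProb ρ π p t x = 1 := by
  simpa using (integral_comp_eval π p ρ t (fun _ => 1)).symm

lemma summable_geometric_mul_visitProb {γ : ℝ} (h0 : 0 ≤ γ) (h1 : γ < 1) (ρ : S → ℝ)
    (π : PolicyVec S A) (p : KernelVec S A) (x : S × A) :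
    Summable fun t => γ ^ t * visitProb ρ π p t x :=
  (summable_geometric_of_lt_one h0 h1).of_nonneg_of_le
    (fun t => mul_nonneg (pow_nonneg h0 t) (visitProb_nonneg _ _ _ _ _))
    (fun t => mul_le_of_le_one_right (pow_nonneg h0 t) (visitProb_le_one _ _ _ _ _))

/-- The state-action occupancy measure. -/
def occupancy (γ : ℝ) (ρ : S → ℝ) (π : PolicyVec S A) (p : KernelVec S A) (x : S × A) : ℝ :=
  (1 - γ) * ∑' t : ℕ, γ ^ t * visitProb ρ π p t x

lemma stateOccupancy_eq (γ : ℝ) (ρ : S → ℝ) (π : PolicyVec S A) (p : KernelVec S A) (s : S) :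
    stateOccupancy γ ρ π p s = ∑ a, occupancy γ ρ π p (s, a) := rfl

/-- Split off the term `t = 0` of the discounted series and apply `visitProb_succ` to the rest.
Linearity of this equation in the occupancy measure is what makes mixtures tractable. -/
lemma occupancy_flow {γ : ℝ} (h0 : 0 ≤ γ) (h1 : γ < 1) {ρ : S → ℝ} {π : PolicyVec S A}
    {p : KernelVec S A} (hπ : π ∈ policySpace S A) (hp : p ∈ kernelSpace S A)
    (hρ : ρ ∈ stdSimplex ℝ S) (y : S × A) :
    occupancy γ ρ π p y =
      ((1 - γ) * ρ y.1 + γ * ∑ x : S × A, occupancy γ ρ π p x * p (x.1, x.2, y.1)) * π y := by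
  have hs := summable_geometric_mul_visitProb h0 h1 ρ π p
  have h2 : ∑' t : ℕ, γ ^ (t + 1) * visitProb ρ π p (t + 1) y =
      γ * (∑ x : S × A, (∑' t : ℕ, γ ^ t * visitProb ρ π p t x) * p (x.1, x.2, y.1)) * π y := by
    simp_rw [← tsum_mul_right]
    rw [← Summable.tsum_finsetSum fun x _ => (hs x).mul_right _, ← tsum_mul_left, ← tsum_mul_right]
    refine tsum_congr fun t => ?_
    rw [visitProb_succ hπ hp, Finset.sum_mul, Finset.mul_sum, Finset.mul_sum, Finset.sum_mul]
    refine Finset.sum_congr rfl fun x _ => ?_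
    ring
  simp only [occupancy]
  rw [(hs y).tsum_eq_zero_add, h2, visitProb_zero hπ hρ]
  simp_rw [mul_assoc (1 - γ), ← Finset.mul_sum]
  ring

lemma stateOccupancy_flow {γ : ℝ} (h0 : 0 ≤ γ) (h1 : γ < 1) {ρ : S → ℝ} {π : PolicyVec S A}
    {p : KernelVec S A} (hπ : π ∈ policySpace S A) (hp : p ∈ kernelSpace S A)
    (hρ : ρ ∈ stdSimplex ℝ S) (s : S) :
    stateOccupancy γ ρ π p s =
      (1 - γ) * ρ s + γ * ∑ x : S × A, occupancy γ ρ π p x * p (x.1, x.2, s) := by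
  rw [stateOccupancy_eq]
  simp_rw [occupancy_flow h0 h1 hπ hp hρ (s, _)]
  rw [← Finset.mul_sum, (hπ s).2, mul_one]

lemma occupancy_eq_mul {γ : ℝ} (h0 : 0 ≤ γ) (h1 : γ < 1) {ρ : S → ℝ} {π : PolicyVec S A}
    {p : KernelVec S A} (hπ : π ∈ policySpace S A) (hp : p ∈ kernelSpace S A)
    (hρ : ρ ∈ stdSimplex ℝ S) (x : S × A) :
    occupancy γ ρ π p x = stateOccupancy γ ρ π p x.1 * π x := by
  rw [stateOccupancy_flow h0 h1 hπ hp hρ, ← occupancy_flow h0 h1 hπ hp hρ]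

lemma occupancy_nonneg {γ : ℝ} (h0 : 0 ≤ γ) (h1 : γ < 1) (ρ : S → ℝ) (π : PolicyVec S A)
    (p : KernelVec S A) (x : S × A) : 0 ≤ occupancy γ ρ π p x :=
  mul_nonneg (sub_nonneg.2 h1.le) (tsum_nonneg fun t =>
    mul_nonneg (pow_nonneg h0 t) (visitProb_nonneg _ _ _ _ _))

lemma sum_occupancy {γ : ℝ} (h0 : 0 ≤ γ) (h1 : γ < 1) (ρ : S → ℝ) (π : PolicyVec S A)
    (p : KernelVec S A) : ∑ x, occupancy γ ρ π p x = 1 := by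
  simp only [occupancy]
  rw [← Finset.mul_sum, ← Summable.tsum_finsetSum fun x _ =>
    summable_geometric_mul_visitProb h0 h1 ρ π p x]
  simp_rw [← Finset.mul_sum, sum_visitProb, mul_one]
  rw [tsum_geometric_of_lt_one h0 h1, mul_inv_cancel₀ (sub_pos.2 h1).ne']

lemma sum_stateOccupancy {γ : ℝ} (h0 : 0 ≤ γ) (h1 : γ < 1) (ρ : S → ℝ) (π : PolicyVec S A)
    (p : KernelVec S A) : ∑ s, stateOccupancy γ ρ π p s = 1 := by
  simp_rw [stateOccupancy_eq, ← sum_occupancy h0 h1 ρ π p, Fintype.sum_prod_type]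

lemma stateOccupancy_nonneg {γ : ℝ} (h0 : 0 ≤ γ) (h1 : γ < 1) (ρ : S → ℝ) (π : PolicyVec S A)
    (p : KernelVec S A) (s : S) : 0 ≤ stateOccupancy γ ρ π p s :=
  Finset.sum_nonneg fun _ _ => occupancy_nonneg h0 h1 ρ π p _

/-- The regularized value is the average of the regularized reward over the occupancy measure. -/
lemma regValue_eq_sum_occupancy {γ : ℝ} (h0 : 0 ≤ γ) (h1 : γ < 1) (lam : ℝ) (ρ : S → ℝ)
    (π : PolicyVec S A) (p : KernelVec S A) (r : PolicyVec S A) :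
    (1 - γ) * regValue γ lam ρ π p r =
      ∑ x, occupancy γ ρ π p x * (r x - lam * Real.log (π x)) := by
  set c : S × A → ℝ := fun x => r x - lam * Real.log (π x) with hc
  have hint : ∀ t : ℕ, Integrable (fun ω : ℕ → S × A => γ ^ t * c (ω t)) (trajLaw π p ρ) := by
    intro t
    refine Integrable.const_mul ?_ _
    -- Finiteness of `S × A` bounds the regularized reward for a fixed policy, even though the
    -- logarithm is not bounded uniformly in the policy.
    refine Integrable.of_bound (C := ∑ x, |c x|)
      ((Measurable.of_discrete (f := c)).comp (measurable_pi_apply t)).aestronglyMeasurable ?_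
    exact Filter.Eventually.of_forall fun ω =>
      Finset.single_le_sum (f := fun x => |c x|) (fun x _ => abs_nonneg _) (Finset.mem_univ (ω t))
  have hsum : Summable fun t : ℕ => ∫ ω, ‖γ ^ t * c (ω t)‖ ∂(trajLaw π p ρ) := by
    have : ∀ t : ℕ, ∫ ω, ‖γ ^ t * c (ω t)‖ ∂(trajLaw π p ρ) =
        ∑ x, γ ^ t * visitProb ρ π p t x * |c x| := by
      intro t
      rw [integral_comp_eval π p ρ t (fun x => ‖γ ^ t * c x‖)]
      refine Finset.sum_congr rfl fun x _ => ?_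
      rw [norm_mul, Real.norm_of_nonneg (pow_nonneg h0 t), Real.norm_eq_abs]
      ring
    simp_rw [this]
    exact summable_sum fun x _ => (summable_geometric_mul_visitProb h0 h1 ρ π p x).mul_right _
  have key : regValue γ lam ρ π p r = ∑' t : ℕ, ∫ ω, γ ^ t * c (ω t) ∂(trajLaw π p ρ) :=
    (integral_tsum_of_summable_integral_norm hint hsum).symm
  have h2 : ∀ t : ℕ, ∫ ω, γ ^ t * c (ω t) ∂(trajLaw π p ρ) =
      ∑ x, γ ^ t * visitProb ρ π p t x * c x := by
    intro t
    rw [integral_const_mul, integral_comp_eval π p ρ t c, Finset.mul_sum]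
    refine Finset.sum_congr rfl fun x _ => ?_
    ring
  rw [key]
  simp_rw [h2]
  rw [Summable.tsum_finsetSum fun x _ =>
    (summable_geometric_mul_visitProb h0 h1 ρ π p x).mul_right _, Finset.mul_sum]
  refine Finset.sum_congr rfl fun x _ => ?_
  rw [tsum_mul_right, occupancy, mul_assoc]

end Trajectory

open Filter Topology

/-! ### The Bellman equation: solvability, bounds and continuity of state values. -/

section Bellman

variable {S A : Type*} [Fintype S] [Fintype A]

/-- The transition operator `f ↦ 𝔼[f(s_1) | s_0 = s]` on functions of the state. -/
def transitionOp (π : PolicyVec S A) (p : KernelVec S A) (f : S → ℝ) (s : S) : ℝ :=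
  ∑ a, π (s, a) * ∑ s', p (s, a, s') * f s'

/-- The expected one-step regularized reward. -/
def stepReward (lam : ℝ) (π r : PolicyVec S A) (s : S) : ℝ :=
  ∑ a, π (s, a) * (r (s, a) - lam * Real.log (π (s, a)))

lemma transitionOp_le {π : PolicyVec S A} {p : KernelVec S A} (hπ : π ∈ policySpace S A)
    (hp : p ∈ kernelSpace S A) {f : S → ℝ} {C : ℝ} (hf : ∀ s, f s ≤ C) (s : S) :
    transitionOp π p f s ≤ C := by
  have h1 : ∀ a, ∑ s', p (s, a, s') * f s' ≤ C := fun a => by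
    calc ∑ s', p (s, a, s') * f s' ≤ ∑ s', p (s, a, s') * C :=
          Finset.sum_le_sum fun s' _ => mul_le_mul_of_nonneg_left (hf s') ((hp s a).1 s')
      _ = C := by rw [← Finset.sum_mul, (hp s a).2, one_mul]
  calc transitionOp π p f s ≤ ∑ a, π (s, a) * C :=
        Finset.sum_le_sum fun a _ => mul_le_mul_of_nonneg_left (h1 a) ((hπ s).1 a)
    _ = C := by rw [← Finset.sum_mul, (hπ s).2, one_mul]

lemma transitionOp_sub (π : PolicyVec S A) (p : KernelVec S A) (f g : S → ℝ) (s : S) :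
    transitionOp π p (f - g) s = transitionOp π p f s - transitionOp π p g s := by
  simp [transitionOp, mul_sub, Finset.sum_sub_distrib]

lemma transitionOp_neg (π : PolicyVec S A) (p : KernelVec S A) (f : S → ℝ) (s : S) :
    transitionOp π p (-f) s = - transitionOp π p f s := by
  simp [transitionOp]

/-- Maximum principle: evaluate the hypothesis at a maximizer of `f`, where averaging cannot
increase the value. Applied to `f` and `-f`, it yields uniqueness, bounds and stability for the
Bellman equation. -/
lemma le_div_of_le_add_transitionOp [Nonempty S] {γ : ℝ} (h0 : 0 ≤ γ) (h1 : γ < 1)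
    {π : PolicyVec S A} {p : KernelVec S A} (hπ : π ∈ policySpace S A) (hp : p ∈ kernelSpace S A)
    {f : S → ℝ} {c : ℝ} (hf : ∀ s, f s ≤ c + γ * transitionOp π p f s) (s : S) :
    f s ≤ c / (1 - γ) := by
  obtain ⟨m, hm⟩ := Finite.exists_max f
  refine (hm s).trans ?_
  rw [le_div_iff₀ (sub_pos.2 h1)]
  have := mul_le_mul_of_nonneg_left (transitionOp_le hπ hp hm m) h0
  linarith [hf m]

/-- The operator identity minus `γ` times transition is injective by the maximum principle, hence
surjective in finite dimension. -/
lemma exists_bellman [Nonempty S] {γ : ℝ} (h0 : 0 ≤ γ) (h1 : γ < 1)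
    {π : PolicyVec S A} {p : KernelVec S A} (hπ : π ∈ policySpace S A) (hp : p ∈ kernelSpace S A)
    (c : S → ℝ) : ∃ V : S → ℝ, ∀ s, V s = c s + γ * transitionOp π p V s := by
  let T : (S → ℝ) →ₗ[ℝ] (S → ℝ) :=
    { toFun := fun f s => f s - γ * transitionOp π p f s
      map_add' := fun f g => by
        ext s
        simp only [transitionOp, Pi.add_apply, mul_add, Finset.sum_add_distrib]
        ring
      map_smul' := fun k f => by
        ext s
        simp only [transitionOp, Pi.smul_apply, smul_eq_mul, RingHom.id_apply, mul_sub,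
          Finset.mul_sum]
        congr 1
        refine Finset.sum_congr rfl fun a _ => Finset.sum_congr rfl fun s' _ => ?_
        ring }
  have hT : Function.Injective T := by
    rw [← LinearMap.ker_eq_bot, LinearMap.ker_eq_bot']
    intro f hf
    have hfs : ∀ s, f s - γ * transitionOp π p f s = 0 := fun s => congrFun hf s
    ext s
    apply le_antisymm
    · simpa using le_div_of_le_add_transitionOp h0 h1 hπ hp (f := f) (c := 0)
        (fun s => by linarith [hfs s]) s
    · have := le_div_of_le_add_transitionOp h0 h1 hπ hp (f := -f) (c := 0)
        (fun s => by rw [transitionOp_neg, Pi.neg_apply]; linarith [hfs s]) s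
      simpa using this
  obtain ⟨V, hV⟩ := LinearMap.injective_iff_surjective.1 hT c
  refine ⟨V, fun s => ?_⟩
  have : V s - γ * transitionOp π p V s = c s := congrFun hV s
  linarith

open Classical in
/-- The regularized state value function: the solution of the Bellman equation. -/
def stateValue (γ lam : ℝ) (π : PolicyVec S A) (p : KernelVec S A) (r : PolicyVec S A) : S → ℝ :=
  if h : ∃ V : S → ℝ, ∀ s, V s = stepReward lam π r s + γ * transitionOp π p V s then h.choose
  else 0

lemma stateValue_eq [Nonempty S] {γ : ℝ} (h0 : 0 ≤ γ) (h1 : γ < 1)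
    {π : PolicyVec S A} {p : KernelVec S A} (hπ : π ∈ policySpace S A) (hp : p ∈ kernelSpace S A)
    (lam : ℝ) (r : PolicyVec S A) (s : S) :
    stateValue γ lam π p r s =
      stepReward lam π r s + γ * transitionOp π p (stateValue γ lam π p r) s := by
  have h := exists_bellman h0 h1 hπ hp (stepReward lam π r)
  rw [stateValue, dif_pos h]
  exact h.choose_spec s

/-- Integrating the Bellman equation against a state-action distribution with policy `π`. -/
lemma sum_mul_reward_eq [Nonempty S] {γ : ℝ} (h0 : 0 ≤ γ) (h1 : γ < 1)
    {π : PolicyVec S A} {p : KernelVec S A} (hπ : π ∈ policySpace S A) (hp : p ∈ kernelSpace S A)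
    (lam : ℝ) (r : PolicyVec S A) {d : S × A → ℝ} {dS : S → ℝ}
    (hd : ∀ x, d x = dS x.1 * π x) :
    ∑ x, d x * (r x - lam * Real.log (π x)) =
      ∑ s, dS s * stateValue γ lam π p r s -
        γ * ∑ x : S × A, d x * ∑ s', p (x.1, x.2, s') * stateValue γ lam π p r s' := by
  set V := stateValue γ lam π p r
  have e1 : ∑ x, d x * (r x - lam * Real.log (π x)) = ∑ s, dS s * stepReward lam π r s := by
    simp_rw [Fintype.sum_prod_type, hd, stepReward, Finset.mul_sum, mul_assoc]
  have e2 : ∑ x : S × A, d x * ∑ s', p (x.1, x.2, s') * V s' =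
      ∑ s, dS s * transitionOp π p V s := by
    simp_rw [Fintype.sum_prod_type, hd, transitionOp, Finset.mul_sum, mul_assoc]
  rw [e1, e2, Finset.mul_sum, ← Finset.sum_sub_distrib]
  refine Finset.sum_congr rfl fun s _ => ?_
  rw [show V s = stepReward lam π r s + γ * transitionOp π p V s from
    stateValue_eq h0 h1 hπ hp lam r s]
  ring

/-- Jensen's inequality for the concave function `Real.negMulLog` with uniform weights. -/
lemma entropy_le_log_card [Nonempty A] {w : A → ℝ} (hw : w ∈ stdSimplex ℝ A) :
    ∑ a, Real.negMulLog (w a) ≤ Real.log (Fintype.card A) := by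
  have hA : (0 : ℝ) < Fintype.card A := by exact_mod_cast Fintype.card_pos
  have h := Real.concaveOn_negMulLog.le_map_sum (t := Finset.univ)
    (w := fun _ : A => (Fintype.card A : ℝ)⁻¹) (p := w) (fun _ _ => by positivity)
    (by simp) (fun a _ => hw.1 a)
  simp only [smul_eq_mul, ← Finset.mul_sum, hw.2, mul_one] at h
  rw [Real.negMulLog, Real.log_inv, neg_mul_neg] at h
  exact le_of_mul_le_mul_left h (inv_pos.2 hA)

lemma stepReward_eq {S A : Type*} [Fintype A] (lam : ℝ) (π r : PolicyVec S A) (s : S) :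
    stepReward lam π r s =
      ∑ a, π (s, a) * r (s, a) + lam * ∑ a, Real.negMulLog (π (s, a)) := by
  rw [stepReward, Finset.mul_sum, ← Finset.sum_add_distrib]
  refine Finset.sum_congr rfl fun a _ => ?_
  rw [Real.negMulLog]
  ring

lemma policy_le_one {S A : Type*} [Fintype A] {π : PolicyVec S A} (hπ : π ∈ policySpace S A) (x : S × A) : π x ≤ 1 := by
  rw [← (hπ x.1).2]
  exact Finset.single_le_sum (f := fun a => π (x.1, a)) (fun a _ => (hπ x.1).1 a)
    (Finset.mem_univ x.2)

lemma stepReward_nonneg {S A : Type*} [Fintype A] {lam : ℝ} (hl : 0 ≤ lam) {π r : PolicyVec S A}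
    (hπ : π ∈ policySpace S A) (hr : r ∈ rewardSpace S A) (s : S) : 0 ≤ stepReward lam π r s := by
  rw [stepReward_eq]
  exact add_nonneg (Finset.sum_nonneg fun a _ => mul_nonneg ((hπ s).1 a) (hr _).1)
    (mul_nonneg hl (Finset.sum_nonneg fun a _ =>
      Real.negMulLog_nonneg ((hπ s).1 a) (policy_le_one hπ _)))

lemma stepReward_le {S A : Type*} [Fintype A] [Nonempty A] {lam : ℝ} (hl : 0 ≤ lam) {π r : PolicyVec S A}
    (hπ : π ∈ policySpace S A) (hr : r ∈ rewardSpace S A) (s : S) :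
    stepReward lam π r s ≤ 1 + lam * Real.log (Fintype.card A) := by
  rw [stepReward_eq]
  refine add_le_add ?_ (mul_le_mul_of_nonneg_left (entropy_le_log_card (hπ s)) hl)
  rw [← (hπ s).2]
  exact Finset.sum_le_sum fun a _ => mul_le_of_le_one_right ((hπ s).1 a) (hr _).2

lemma stateValue_le [Nonempty S] [Nonempty A] {γ lam : ℝ} (h0 : 0 ≤ γ) (h1 : γ < 1) (hl : 0 ≤ lam)
    {π r : PolicyVec S A} {p : KernelVec S A} (hπ : π ∈ policySpace S A)
    (hp : p ∈ kernelSpace S A) (hr : r ∈ rewardSpace S A) (s : S) :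
    stateValue γ lam π p r s ≤ (1 + lam * Real.log (Fintype.card A)) / (1 - γ) := by
  refine le_div_of_le_add_transitionOp h0 h1 hπ hp (fun s => ?_) s
  rw [stateValue_eq h0 h1 hπ hp]
  linarith [stepReward_le hl hπ hr s, stateValue_eq h0 h1 hπ hp lam r s]

lemma stateValue_nonneg [Nonempty S] {γ lam : ℝ} (h0 : 0 ≤ γ) (h1 : γ < 1) (hl : 0 ≤ lam)
    {π r : PolicyVec S A} {p : KernelVec S A} (hπ : π ∈ policySpace S A)
    (hp : p ∈ kernelSpace S A) (hr : r ∈ rewardSpace S A) (s : S) :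
    0 ≤ stateValue γ lam π p r s := by
  have := le_div_of_le_add_transitionOp h0 h1 hπ hp (f := -stateValue γ lam π p r) (c := 0)
    (fun s => by
      rw [transitionOp_neg, Pi.neg_apply]
      linarith [stepReward_nonneg hl hπ hr s, stateValue_eq h0 h1 hπ hp lam r s]) s
  simpa using this

lemma continuousOn_stateValue [Nonempty S] {γ lam : ℝ} (h0 : 0 ≤ γ) (h1 : γ < 1)
    {P : PolicyVec S A → KernelVec S A} {r : PolicyVec S A → PolicyVec S A}
    (hPm : ∀ π ∈ policySpace S A, P π ∈ kernelSpace S A)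
    (hP : ContinuousOn P (policySpace S A)) (hr : ContinuousOn r (policySpace S A)) (s : S) :
    ContinuousOn (fun π => stateValue γ lam π (P π) (r π) s) (policySpace S A) := by
  intro π₀ hπ₀
  set V : PolicyVec S A → S → ℝ := fun π => stateValue γ lam π (P π) (r π) with hV
  -- `E π` is the residual of the fixed function `V π₀` in the Bellman equation of `π`. The
  -- difference `V π - V π₀` solves that equation with source `E π`, so the maximum principle bounds
  -- it by `e π / (1 - γ)`.
  set E : PolicyVec S A → S → ℝ := fun π s => stepReward lam π (r π) s - stepReward lam π₀ (r π₀) s +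
    γ * (transitionOp π (P π) (V π₀) s - transitionOp π₀ (P π₀) (V π₀) s) with hE
  set e : PolicyVec S A → ℝ := fun π => ∑ s, |E π s| with he
  have hcoord : ∀ x : S × A, ContinuousWithinAt (fun π : PolicyVec S A => π x) (policySpace S A) π₀ :=
    fun x => (by fun_prop : Continuous fun π : PolicyVec S A => π x).continuousWithinAt
  have hPc : ∀ x, ContinuousWithinAt (fun π => P π x) (policySpace S A) π₀ := fun x =>
    (by fun_prop : Continuous fun q : KernelVec S A => q x).continuousAt.comp_continuousWithinAt
      (hP π₀ hπ₀)
  have hrc : ∀ x, ContinuousWithinAt (fun π => r π x) (policySpace S A) π₀ := fun x =>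
    (by fun_prop : Continuous fun q : PolicyVec S A => q x).continuousAt.comp_continuousWithinAt
      (hr π₀ hπ₀)
  have hEc : ∀ s, ContinuousWithinAt (fun π => E π s) (policySpace S A) π₀ := by
    intro s
    -- The logarithm is discontinuous at `0`, so continuity at boundary policies is available only
    -- for the product with the action probability.
    have hlog : ∀ a, ContinuousWithinAt (fun π : PolicyVec S A => Real.negMulLog (π (s, a)))
        (policySpace S A) π₀ := fun a =>
      Real.continuous_negMulLog.continuousAt.comp_continuousWithinAt (hcoord (s, a))
    have hR : ContinuousWithinAt (fun π => stepReward lam π (r π) s) (policySpace S A) π₀ := by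
      simp only [stepReward_eq]
      refine ContinuousWithinAt.add (tendsto_finsetSum _ fun a _ => (hcoord (s, a)).mul (hrc (s, a)))
        (ContinuousWithinAt.mul continuousWithinAt_const (tendsto_finsetSum _ fun a _ => hlog a))
    have hT : ContinuousWithinAt (fun π => transitionOp π (P π) (V π₀) s) (policySpace S A) π₀ :=
      tendsto_finsetSum _ fun a _ => (hcoord (s, a)).mul
        (tendsto_finsetSum _ fun s' _ => (hPc (s, a, s')).mul continuousWithinAt_const)
    exact (hR.sub continuousWithinAt_const).add ((hT.sub continuousWithinAt_const).const_mul γ)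
  have hec : Tendsto e (𝓝[policySpace S A] π₀) (𝓝 0) := by
    have h : ContinuousWithinAt e (policySpace S A) π₀ := by
      exact tendsto_finsetSum _ fun s _ => (hEc s).abs
    have h2 : e π₀ = 0 := by simp [he, hE]
    rw [← h2]
    exact h
  have hbound : ∀ π ∈ policySpace S A, |V π s - V π₀ s| ≤ e π / (1 - γ) := by
    intro π hπ
    have hEe : ∀ s, |E π s| ≤ e π := fun s =>
      Finset.single_le_sum (f := fun s => |E π s|) (fun _ _ => abs_nonneg _) (Finset.mem_univ s)
    have hdiff : ∀ s, (V π - V π₀) s = E π s + γ * transitionOp π (P π) (V π - V π₀) s := by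
      intro s
      rw [transitionOp_sub, Pi.sub_apply]
      have a1 : V π s = _ := stateValue_eq h0 h1 hπ (hPm π hπ) lam (r π) s
      have a2 : V π₀ s = _ := stateValue_eq h0 h1 hπ₀ (hPm π₀ hπ₀) lam (r π₀) s
      simp only [hE]
      simp only [hV] at a1 a2 ⊢
      linarith
    rw [abs_le']
    constructor
    · exact le_div_of_le_add_transitionOp h0 h1 hπ (hPm π hπ) (f := V π - V π₀) (fun s => by
        linarith [hdiff s, (abs_le.1 (hEe s)).2]) s
    · have := le_div_of_le_add_transitionOp h0 h1 hπ (hPm π hπ) (f := -(V π - V π₀)) (c := e π)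
        (fun s => by
          rw [transitionOp_neg, Pi.neg_apply]
          linarith [hdiff s, (abs_le.1 (hEe s)).1]) s
      simpa using this
  have hlim : Tendsto (fun π => V π s - V π₀ s) (𝓝[policySpace S A] π₀) (𝓝 0) := by
    refine squeeze_zero_norm' (a := fun π => e π / (1 - γ)) ?_ (by simpa using hec.div_const (1 - γ))
    filter_upwards [self_mem_nhdsWithin] with π hπ
    exact hbound π hπ
  exact tendsto_sub_nhds_zero_iff.1 hlim

variable [Nonempty S] [Nonempty A] [MeasurableSpace S] [DiscreteMeasurableSpace S]
  [MeasurableSpace A] [DiscreteMeasurableSpace A]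

/-- Integrate the Bellman equation against the occupancy measure; the flow equation cancels
everything except the initial term `(1 - γ) ρ`. -/
lemma regValue_eq_sum_stateValue {γ : ℝ} (h0 : 0 ≤ γ) (h1 : γ < 1) (lam : ℝ) {ρ : S → ℝ}
    {π : PolicyVec S A} {p : KernelVec S A} (hπ : π ∈ policySpace S A) (hp : p ∈ kernelSpace S A)
    (hρ : ρ ∈ stdSimplex ℝ S) (r : PolicyVec S A) :
    regValue γ lam ρ π p r = ∑ s, ρ s * stateValue γ lam π p r s := by
  have h := regValue_eq_sum_occupancy h0 h1 lam ρ π p r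
  rw [sum_mul_reward_eq h0 h1 hπ hp lam r (occupancy_eq_mul h0 h1 hπ hp hρ)] at h
  have e : ∑ x : S × A, occupancy γ ρ π p x *
      ∑ s', p (x.1, x.2, s') * stateValue γ lam π p r s' =
      ∑ s', (∑ x : S × A, occupancy γ ρ π p x * p (x.1, x.2, s')) * stateValue γ lam π p r s' := by
    simp_rw [Finset.mul_sum, Finset.sum_mul, mul_assoc]
    exact Finset.sum_comm
  rw [e, Finset.mul_sum, ← Finset.sum_sub_distrib] at h
  refine mul_left_cancel₀ (sub_pos.2 h1).ne' (h.trans ?_)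
  rw [Finset.mul_sum]
  refine Finset.sum_congr rfl fun s _ => ?_
  rw [stateOccupancy_flow h0 h1 hπ hp hρ]
  ring

end Bellman

/-! ### Gradients within a convex set: chain rule along curves, descent lemma, weighted variations.
-/

section Gradient

variable {E : Type*} [NormedAddCommGroup E] [InnerProductSpace ℝ E]

lemma hasDerivWithinAt_add_smul (x a : E) (s : Set ℝ) (t : ℝ) :
    HasDerivWithinAt (fun τ : ℝ => x + τ • a) a s t := by
  simpa using ((hasDerivWithinAt_id t s).smul_const a).const_add x

lemma mapsTo_add_smul {C : Set E} (hC : Convex ℝ C) {x a : E} (hx : x ∈ C) (ha : x + a ∈ C) :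
    Set.MapsTo (fun τ : ℝ => x + τ • a) (Set.Icc 0 1) C := fun _ ht =>
  hC.add_smul_mem hx ha ht

variable [CompleteSpace E]

lemma hasDerivWithinAt_comp_of_hasGradientWithinAt {f : E → ℝ} {g x v : E} {C : Set E}
    (hf : HasGradientWithinAt f g C x) {c : ℝ → E} {s : Set ℝ} {t : ℝ}
    (hc : HasDerivWithinAt c v s t) (hct : c t = x) (hmaps : Set.MapsTo c s C) :
    HasDerivWithinAt (fun τ => f (c τ)) (inner ℝ g v) s t := by
  have h := hf.hasFDerivWithinAt
  rw [← hct] at h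
  exact h.comp_hasDerivWithinAt t hc hmaps

lemma tendsto_div_of_hasGradientWithinAt {f : E → ℝ} {g x v : E} {C : Set E}
    (hf : HasGradientWithinAt f g C x) {c : ℝ → E}
    (hc : HasDerivWithinAt c v (Set.Icc 0 1) 0) (hc0 : c 0 = x)
    (hmaps : Set.MapsTo c (Set.Icc 0 1) C) :
    Tendsto (fun t => (f (c t) - f x) / t) (𝓝[Set.Ioc 0 1] (0 : ℝ)) (𝓝 (inner ℝ g v)) := by
  have h := (hasDerivWithinAt_iff_tendsto_slope.1
    (hasDerivWithinAt_comp_of_hasGradientWithinAt hf hc hc0 hmaps))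
  have e : Set.Icc (0 : ℝ) 1 \ {0} = Set.Ioc 0 1 := by
    ext t
    simp only [Set.mem_sdiff, Set.mem_Icc, Set.mem_singleton_iff, Set.mem_Ioc]
    constructor
    · rintro ⟨⟨a, b⟩, c⟩
      exact ⟨lt_of_le_of_ne a (Ne.symm c), b⟩
    · rintro ⟨a, b⟩
      exact ⟨⟨a.le, b⟩, a.ne'⟩
  rw [e] at h
  refine h.congr fun t => ?_
  rw [slope_def_field, hc0, sub_zero]

/-- Lets inequalities between difference quotients pass to the limit as time tends to `0` from the
right. -/
instance neBot_nhdsWithin_Ioc_zero : (𝓝[Set.Ioc 0 1] (0 : ℝ)).NeBot := by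
  rw [nhdsWithin_Ioc_eq_nhdsGT zero_lt_one]
  infer_instance

/-- The derivative of a Lipschitz map is bounded on differences of feasible directions. -/
lemma sum_sq_inner_gradient_le {ι : Type*} [Fintype ι] {F : E → EuclideanSpace ℝ ι} {C : Set E}
    (hC : Convex ℝ C) {K : ℝ} (hF : ∀ x ∈ C, ∀ y ∈ C, ‖F y - F x‖ ≤ K * ‖y - x‖) {x : E}
    (hx : x ∈ C) {g : ι → E} (hg : ∀ k, HasGradientWithinAt (fun y => F y k) (g k) C x) {a b : E}
    {η : ℝ} (hη : 0 < η) (ha : x + η • a ∈ C) (hb : x + η • b ∈ C) :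
    ∑ k, (inner ℝ (g k) (a - b)) ^ 2 ≤ (K * ‖a - b‖) ^ 2 := by
  -- Gradients within `C` are controlled only along feasible directions, and `a - b` need not be
  -- one. So two segments issuing from `x` are compared with each other, and the Lipschitz bound is
  -- applied between their points at the same time.
  have key : ∑ k, (inner ℝ (g k) (η • a) - inner ℝ (g k) (η • b)) ^ 2 ≤
      (K * ‖η • a - η • b‖) ^ 2 := by
    have hlim : Tendsto (fun t : ℝ => ∑ k, ((F (x + t • η • a) k - F x k) / t -
        (F (x + t • η • b) k - F x k) / t) ^ 2) (𝓝[Set.Ioc 0 1] (0 : ℝ))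
        (𝓝 (∑ k, (inner ℝ (g k) (η • a) - inner ℝ (g k) (η • b)) ^ 2)) := by
      refine tendsto_finsetSum _ fun k _ => Tendsto.pow (Tendsto.sub ?_ ?_) 2
      · exact tendsto_div_of_hasGradientWithinAt (hg k) (hasDerivWithinAt_add_smul x _ _ _)
          (by simp) (mapsTo_add_smul hC hx ha)
      · exact tendsto_div_of_hasGradientWithinAt (hg k) (hasDerivWithinAt_add_smul x _ _ _)
          (by simp) (mapsTo_add_smul hC hx hb)
    refine le_of_tendsto hlim ?_
    filter_upwards [self_mem_nhdsWithin] with t ht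
    have hta := mapsTo_add_smul hC hx ha (Set.Ioc_subset_Icc_self ht)
    have htb := mapsTo_add_smul hC hx hb (Set.Ioc_subset_Icc_self ht)
    have h1 := hF _ htb _ hta
    have h2 : ‖x + t • η • a - (x + t • η • b)‖ = t * ‖η • a - η • b‖ := by
      rw [add_sub_add_left_eq_sub, ← smul_sub, norm_smul, Real.norm_of_nonneg ht.1.le]
    simp only at h1
    rw [h2] at h1
    have h3 : ∑ k, ((F (x + t • η • a) k - F x k) / t - (F (x + t • η • b) k - F x k) / t) ^ 2 =
        (‖F (x + t • η • a) - F (x + t • η • b)‖ / t) ^ 2 := by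
      rw [div_pow, EuclideanSpace.norm_sq_eq, Finset.sum_div]
      refine Finset.sum_congr rfl fun k _ => ?_
      rw [PiLp.sub_apply, Real.norm_eq_abs, sq_abs]
      ring
    rw [h3]
    refine pow_le_pow_left₀ (div_nonneg (norm_nonneg _) ht.1.le) ?_ 2
    rw [div_le_iff₀ ht.1]
    linarith
  rw [← smul_sub, norm_smul, Real.norm_of_nonneg hη.le] at key
  simp_rw [← inner_sub_right, ← smul_sub, real_inner_smul_right, mul_pow, ← Finset.mul_sum] at key
  rw [mul_pow]
  refine le_of_mul_le_mul_left ?_ (pow_pos hη 2)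
  linarith

/-- Descent lemma: quadratic upper bound for a function with Lipschitz gradient within a convex
set. -/
lemma sub_le_inner_add_of_lipschitz_gradient {f : E → ℝ} {g : E → E} {C : Set E}
    (hC : Convex ℝ C) {L : ℝ} (hf : ∀ x ∈ C, HasGradientWithinAt f (g x) C x)
    (hg : ∀ x ∈ C, ∀ y ∈ C, ‖g y - g x‖ ≤ L * ‖y - x‖) {x y : E} (hx : x ∈ C) (hy : y ∈ C) :
    f y - f x ≤ inner ℝ (g x) (y - x) + L / 2 * ‖y - x‖ ^ 2 := by
  set u := y - x with hu
  have hyu : x + u ∈ C := by simpa [hu] using hy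
  have hmaps := mapsTo_add_smul hC hx hyu
  -- The Taylor error along the segment minus its claimed bound; the Lipschitz gradient makes the
  -- derivative nonpositive, and the claim compares times `0` and `1`.
  set h : ℝ → ℝ := fun t => f (x + t • u) - t * inner ℝ (g x) u - L / 2 * ‖u‖ ^ 2 * t ^ 2 with hh
  have hd : ∀ t ∈ Set.Icc (0 : ℝ) 1, HasDerivWithinAt h
      (inner ℝ (g (x + t • u)) u - inner ℝ (g x) u - L * ‖u‖ ^ 2 * t) (Set.Icc 0 1) t := by
    intro t ht
    have d1 := hasDerivWithinAt_comp_of_hasGradientWithinAt (hf _ (hmaps ht))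
      (hasDerivWithinAt_add_smul x u (Set.Icc 0 1) t) rfl hmaps
    have d2 := (hasDerivWithinAt_id t (Set.Icc (0 : ℝ) 1)).mul_const (inner ℝ (g x) u)
    have d3 := ((hasDerivWithinAt_id t (Set.Icc (0 : ℝ) 1)).pow 2).const_mul (L / 2 * ‖u‖ ^ 2)
    refine ((d1.sub d2).sub d3).congr_deriv ?_
    simp
    ring
  have hanti : AntitoneOn h (Set.Icc 0 1) := by
    refine antitoneOn_of_hasDerivWithinAt_nonpos (convex_Icc 0 1)
      (fun t ht => (hd t ht).continuousWithinAt)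
      (fun t ht => (hd t (interior_subset ht)).mono interior_subset) ?_
    intro t ht
    have ht' := interior_subset ht
    have h1 := hg x hx _ (hmaps ht')
    have h2 : ‖x + t • u - x‖ = t * ‖u‖ := by
      rw [add_sub_cancel_left, norm_smul, Real.norm_of_nonneg ht'.1]
    simp only at h1
    rw [h2] at h1
    have h3 := real_inner_le_norm (g (x + t • u) - g x) u
    rw [inner_sub_left] at h3
    nlinarith [mul_le_mul_of_nonneg_right h1 (norm_nonneg u)]
  have := hanti (Set.left_mem_Icc.2 zero_le_one) (Set.right_mem_Icc.2 zero_le_one) zero_le_one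
  have e1 : x + u = y := by simp [hu]
  simp only [hh, one_smul, e1, zero_smul, add_zero] at this
  linarith

lemma abs_sum_mul_le_of_sum_sq_le {ι : Type*} [Fintype ι] {a b : ι → ℝ} {A B : ℝ} (hA : 0 ≤ A)
    (hB : 0 ≤ B) (ha : ∑ k, a k ^ 2 ≤ A ^ 2) (hb : ∑ k, b k ^ 2 ≤ B ^ 2) :
    |∑ k, a k * b k| ≤ A * B := by
  refine abs_le_of_sq_le_sq ?_ (mul_nonneg hA hB)
  rw [mul_pow]
  exact (Finset.sum_mul_sq_le_sq_mul_sq _ _ _).trans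
    (mul_le_mul ha hb (Finset.sum_nonneg fun _ _ => sq_nonneg _) (sq_nonneg _))

/-- Lower bound for a weighted first-order variation of a Lipschitz smooth map. -/
lemma le_sum_weighted_variation {ι : Type*} [Fintype ι] {F : E → EuclideanSpace ℝ ι} {C : Set E}
    (hC : Convex ℝ C) {K L : ℝ} (hK : 0 ≤ K) (hL : 0 ≤ L)
    (hF : ∀ x ∈ C, ∀ y ∈ C, ‖F y - F x‖ ≤ K * ‖y - x‖)
    {g : ι → E → E} (hg : ∀ k, ∀ x ∈ C, HasGradientWithinAt (fun y => F y k) (g k x) C x)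
    (hgL : ∀ k, ∀ x ∈ C, ∀ y ∈ C, ‖g k y - g k x‖ ≤ L * ‖y - x‖)
    {x y v : E} (hx : x ∈ C) (hy : y ∈ C) {η : ℝ} (hη : 0 < η) (hη1 : η ≤ 1) (hv : x + η • v ∈ C)
    {c₀ c₁ : ι → ℝ} {B₀ B B₁ : ℝ} (hB₀ : 0 ≤ B₀) (hB : 0 ≤ B) (hc₁ : ∀ k, 0 ≤ c₁ k)
    (h₀ : ∑ k, c₀ k ^ 2 ≤ B₀ ^ 2) (h : ∑ k, (c₀ k - c₁ k) ^ 2 ≤ B ^ 2) (h₁ : ∑ k, c₁ k ≤ B₁) :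
    -(K * (B₀ * ‖v - (y - x)‖ + B * ‖y - x‖) + B₁ * (L / 2 * ‖y - x‖ ^ 2)) ≤
      ∑ k, (c₀ k * inner ℝ (g k x) v - c₁ k * (F y k - F x k)) := by
  set u := y - x with hu
  have hux : x + η • u ∈ C := hC.add_smul_mem hx (by simpa [hu] using hy) ⟨hη.le, hη1⟩
  have a1 := abs_sum_mul_le_of_sum_sq_le hB₀ (mul_nonneg hK (norm_nonneg (v - u))) h₀
    (sum_sq_inner_gradient_le hC hF hx (fun k => hg k x hx) hη hv hux)
  -- With the zero direction as the second one, the difference bound controls the single feasible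
  -- direction `u`.
  have b2 := sum_sq_inner_gradient_le hC hF hx (fun k => hg k x hx) (b := 0) hη hux (by simpa)
  rw [sub_zero] at b2
  have a2 := abs_sum_mul_le_of_sum_sq_le hB (mul_nonneg hK (norm_nonneg u)) h b2
  have a3 : ∑ k, c₁ k * (F y k - F x k - inner ℝ (g k x) u) ≤ B₁ * (L / 2 * ‖u‖ ^ 2) := by
    calc ∑ k, c₁ k * (F y k - F x k - inner ℝ (g k x) u) ≤ ∑ k, c₁ k * (L / 2 * ‖u‖ ^ 2) := by
          refine Finset.sum_le_sum fun k _ => mul_le_mul_of_nonneg_left ?_ (hc₁ k)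
          have := sub_le_inner_add_of_lipschitz_gradient hC (hg k) (hgL k) hx hy
          linarith
      _ ≤ _ := by
          rw [← Finset.sum_mul]
          exact mul_le_mul_of_nonneg_right h₁ (by positivity)
  -- Three sources of error: the direction `v` instead of `u`, the weight `c₀` instead of `c₁`, and
  -- the Taylor remainder. In the applications each is quadratic in `‖u‖`.
  have e : ∑ k, (c₀ k * inner ℝ (g k x) v - c₁ k * (F y k - F x k)) =
      ∑ k, c₀ k * inner ℝ (g k x) (v - u) + ∑ k, (c₀ k - c₁ k) * inner ℝ (g k x) u -
        ∑ k, c₁ k * (F y k - F x k - inner ℝ (g k x) u) := by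
    rw [← Finset.sum_add_distrib, ← Finset.sum_sub_distrib]
    refine Finset.sum_congr rfl fun k _ => ?_
    rw [inner_sub_right]
    ring
  rw [e]
  have := (abs_le.1 a1).1
  have := (abs_le.1 a2).1
  linarith

end Gradient

/-! ### Strong convexity of `x log x` and Cauchy–Schwarz estimates. -/

section Convexity

/-- `x log x` is `1`-strongly convex on the unit interval. -/
lemma mul_log_strong_convexity {x y β : ℝ} (hx : x ∈ Set.Icc (0 : ℝ) 1) (hy : y ∈ Set.Icc (0 : ℝ) 1)
    (hβ : β ∈ Set.Icc (0 : ℝ) 1) {z : ℝ} (hz : z = x + β * (y - x)) :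
    z * Real.log z + β * (1 - β) / 2 * (y - x) ^ 2 ≤
      (1 - β) * (x * Real.log x) + β * (y * Real.log y) := by
  -- The second derivative `1 / x - 1` is nonnegative on the open interval; continuity of `x log x`
  -- extends convexity to the endpoints.
  have hconv : ConvexOn ℝ (Set.Icc (0 : ℝ) 1) fun x => x * Real.log x - x ^ 2 / 2 := by
    refine convexOn_of_hasDerivWithinAt2_nonneg (convex_Icc 0 1) (f' := fun x => Real.log x + 1 - x)
      (f'' := fun x => x⁻¹ - 1) ?_ ?_ ?_ ?_
    · exact (Real.continuous_mul_log.sub (by fun_prop)).continuousOn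
    all_goals
      intro t ht
      rw [interior_Icc] at ht
    · have h1 := Real.hasDerivAt_mul_log ht.1.ne'
      have h2 := ((hasDerivAt_id t).pow 2).div_const 2
      refine ((h1.sub h2).congr_deriv ?_).hasDerivWithinAt
      simp
    · have h1 := Real.hasDerivAt_log ht.1.ne'
      exact ((h1.add_const 1).sub (hasDerivAt_id t)).hasDerivWithinAt
    · exact sub_nonneg.2 (one_le_inv_iff₀.2 ⟨ht.1, ht.2.le⟩)
  have h := hconv.2 hx hy (sub_nonneg.2 hβ.2) hβ.1 (by ring)
  have e : (1 - β) • x + β • y = z := by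
    rw [hz]
    simp only [smul_eq_mul]
    ring
  rw [e] at h
  simp only [smul_eq_mul] at h
  have e2 : z ^ 2 = (1 - β) * x ^ 2 + β * y ^ 2 - β * (1 - β) * (y - x) ^ 2 := by
    rw [hz]
    ring
  linarith

lemma sum_sq_le_one {ι : Type*} [Fintype ι] {d : ι → ℝ} (h0 : ∀ i, 0 ≤ d i) (h1 : ∑ i, d i = 1) :
    ∑ i, d i ^ 2 ≤ 1 := by
  simpa [h1] using Finset.sum_sq_le_sq_sum_of_nonneg (s := Finset.univ) fun i _ => h0 i

lemma sum_sq_le_sq_of_sum_abs_le {ι : Type*} [Fintype ι] {d : ι → ℝ} {C : ℝ}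
    (h : ∑ i, |d i| ≤ C) : ∑ i, d i ^ 2 ≤ C ^ 2 := by
  have h2 := Finset.sum_sq_le_sq_sum_of_nonneg (s := Finset.univ) (f := fun i => |d i|)
    fun i _ => abs_nonneg _
  simp only [sq_abs] at h2
  exact h2.trans (pow_le_pow_left₀ (Finset.sum_nonneg fun _ _ => abs_nonneg _) h 2)

lemma sum_mul_abs_le {ι : Type*} [Fintype ι] {c : ι → ℝ} {B : ℝ} (hB : 0 ≤ B)
    (hc : ∑ i, c i ^ 2 ≤ B ^ 2) (u : EuclideanSpace ℝ ι) : ∑ i, c i * |u i| ≤ B * ‖u‖ := by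
  refine (le_abs_self _).trans (abs_sum_mul_le_of_sum_sq_le hB (norm_nonneg u) hc ?_)
  simp [EuclideanSpace.norm_sq_eq]

lemma norm_le_of_abs_le_mul {ι : Type*} [Fintype ι] {u v : EuclideanSpace ℝ ι} {C : ℝ} (hC : 0 ≤ C)
    (h : ∀ i, |v i| ≤ C * |u i|) : ‖v‖ ≤ C * ‖u‖ := by
  refine le_of_sq_le_sq ?_ (mul_nonneg hC (norm_nonneg u))
  rw [mul_pow, EuclideanSpace.norm_sq_eq, EuclideanSpace.norm_sq_eq, Finset.mul_sum]
  refine Finset.sum_le_sum fun i _ => ?_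
  rw [← mul_pow]
  exact pow_le_pow_left₀ (norm_nonneg _) (h i) 2

end Convexity

/-! ### Lipschitz dependence of occupancy measures on policy and kernel, in `ℓ¹`. -/

section OccupancyDifference

variable {S A : Type*} [Fintype S] [Fintype A] [Nonempty S] [Nonempty A]
  [MeasurableSpace S] [DiscreteMeasurableSpace S]
  [MeasurableSpace A] [DiscreteMeasurableSpace A]

variable {γ : ℝ} {ρ : S → ℝ} {π₀ π₁ : PolicyVec S A} {p₀ p₁ : KernelVec S A}

lemma sum_abs_occupancy_sub_le (h0 : 0 ≤ γ) (h1 : γ < 1) (hρ : ρ ∈ stdSimplex ℝ S)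
    (hπ₀ : π₀ ∈ policySpace S A) (hπ₁ : π₁ ∈ policySpace S A)
    (hp₀ : p₀ ∈ kernelSpace S A) (hp₁ : p₁ ∈ kernelSpace S A) :
    ∑ x, |occupancy γ ρ π₁ p₁ x - occupancy γ ρ π₀ p₀ x| ≤
      ∑ s, |stateOccupancy γ ρ π₁ p₁ s - stateOccupancy γ ρ π₀ p₀ s| +
        √(Fintype.card A) * ‖π₁ - π₀‖ := by
  set D₀ := stateOccupancy γ ρ π₀ p₀
  set D₁ := stateOccupancy γ ρ π₁ p₁
  have hD₀ : ∀ s, 0 ≤ D₀ s := stateOccupancy_nonneg h0 h1 ρ π₀ p₀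
  calc ∑ x, |occupancy γ ρ π₁ p₁ x - occupancy γ ρ π₀ p₀ x|
      ≤ ∑ x : S × A, (|D₁ x.1 - D₀ x.1| * π₁ x + D₀ x.1 * |(π₁ - π₀) x|) := by
        refine Finset.sum_le_sum fun x _ => ?_
        have e : occupancy γ ρ π₁ p₁ x - occupancy γ ρ π₀ p₀ x =
            (D₁ x.1 - D₀ x.1) * π₁ x + D₀ x.1 * (π₁ - π₀) x := by
          rw [occupancy_eq_mul h0 h1 hπ₁ hp₁ hρ, occupancy_eq_mul h0 h1 hπ₀ hp₀ hρ,
            PiLp.sub_apply]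
          ring
        rw [e]
        refine (abs_add_le _ _).trans_eq ?_
        rw [abs_mul, abs_mul, abs_of_nonneg (hD₀ x.1), abs_of_nonneg ((hπ₁ x.1).1 x.2)]
    _ ≤ _ := by
        rw [Finset.sum_add_distrib]
        refine add_le_add (le_of_eq ?_) (sum_mul_abs_le (c := fun x : S × A => D₀ x.1)
          (Real.sqrt_nonneg _) ?_ _)
        · rw [Fintype.sum_prod_type]
          refine Finset.sum_congr rfl fun s _ => ?_
          dsimp only
          rw [← Finset.mul_sum, (hπ₁ s).2, mul_one]
        · rw [Real.sq_sqrt (Nat.cast_nonneg _), Fintype.sum_prod_type]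
          simp only [Finset.sum_const, Finset.card_univ, nsmul_eq_mul]
          rw [← Finset.mul_sum]
          exact mul_le_of_le_one_right (Nat.cast_nonneg _)
            (sum_sq_le_one hD₀ (sum_stateOccupancy h0 h1 ρ π₀ p₀))

/-- The flow equation bounds the state difference by `γ` times the state-action difference plus a
kernel term, while `sum_abs_occupancy_sub_le` bounds the latter difference by the former plus a
policy term. Solving this loop produces the factor `1 / (1 - γ)`. -/
lemma sum_abs_stateOccupancy_sub_le (h0 : 0 ≤ γ) (h1 : γ < 1) (hρ : ρ ∈ stdSimplex ℝ S)
    (hπ₀ : π₀ ∈ policySpace S A) (hπ₁ : π₁ ∈ policySpace S A)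
    (hp₀ : p₀ ∈ kernelSpace S A) (hp₁ : p₁ ∈ kernelSpace S A) :
    ∑ s, |stateOccupancy γ ρ π₁ p₁ s - stateOccupancy γ ρ π₀ p₀ s| ≤
      γ * (√(Fintype.card A) * ‖π₁ - π₀‖ + √(Fintype.card S) * ‖p₁ - p₀‖) / (1 - γ) := by
  have hsa := sum_abs_occupancy_sub_le h0 h1 hρ hπ₀ hπ₁ hp₀ hp₁
  set d₀ := occupancy γ ρ π₀ p₀
  set d₁ := occupancy γ ρ π₁ p₁
  have hd₀ : ∀ x, 0 ≤ d₀ x := occupancy_nonneg h0 h1 ρ π₀ p₀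
  have hk : ∑ s, |stateOccupancy γ ρ π₁ p₁ s - stateOccupancy γ ρ π₀ p₀ s| ≤
      γ * (∑ x, |d₁ x - d₀ x| + √(Fintype.card S) * ‖p₁ - p₀‖) := by
    calc ∑ s, |stateOccupancy γ ρ π₁ p₁ s - stateOccupancy γ ρ π₀ p₀ s|
        ≤ ∑ s, γ * ∑ x : S × A, (|d₁ x - d₀ x| * p₁ (x.1, x.2, s) +
            d₀ x * |(p₁ - p₀) (x.1, x.2, s)|) := by
          refine Finset.sum_le_sum fun s _ => ?_
          have e : stateOccupancy γ ρ π₁ p₁ s - stateOccupancy γ ρ π₀ p₀ s =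
              γ * ∑ x : S × A, ((d₁ x - d₀ x) * p₁ (x.1, x.2, s) +
                d₀ x * (p₁ - p₀) (x.1, x.2, s)) := by
            rw [stateOccupancy_flow h0 h1 hπ₁ hp₁ hρ, stateOccupancy_flow h0 h1 hπ₀ hp₀ hρ,
              add_sub_add_left_eq_sub, ← mul_sub, ← Finset.sum_sub_distrib]
            congr 1
            refine Finset.sum_congr rfl fun x _ => ?_
            rw [PiLp.sub_apply]
            ring
          rw [e, abs_mul, abs_of_nonneg h0]
          refine mul_le_mul_of_nonneg_left ((Finset.abs_sum_le_sum_abs _ _).trans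
            (Finset.sum_le_sum fun x _ => ?_)) h0
          refine (abs_add_le _ _).trans_eq ?_
          rw [abs_mul, abs_mul, abs_of_nonneg (hd₀ x), abs_of_nonneg ((hp₁ x.1 x.2).1 s)]
      _ = γ * (∑ x, |d₁ x - d₀ x| +
            ∑ k : S × A × S, d₀ (k.1, k.2.1) * |(p₁ - p₀) k|) := by
          rw [← Finset.mul_sum, Finset.sum_comm]
          simp_rw [Finset.sum_add_distrib, ← Finset.mul_sum, (hp₁ _ _).2, mul_one,
            Fintype.sum_prod_type, ← Finset.mul_sum]
      _ ≤ _ := by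
          refine mul_le_mul_of_nonneg_left (add_le_add le_rfl
            (sum_mul_abs_le (c := fun k : S × A × S => d₀ (k.1, k.2.1)) (Real.sqrt_nonneg _) ?_ _)) h0
          rw [Real.sq_sqrt (Nat.cast_nonneg _)]
          have := sum_sq_le_one hd₀ (sum_occupancy h0 h1 ρ π₀ p₀)
          simp only [Fintype.sum_prod_type, Finset.sum_const, Finset.card_univ, nsmul_eq_mul,
            ← Finset.mul_sum] at this ⊢
          exact mul_le_of_le_one_right (Nat.cast_nonneg _) this
  rw [le_div_iff₀ (sub_pos.2 h1)]
  have := hk.trans (mul_le_mul_of_nonneg_left (add_le_add_left hsa _) h0)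
  linarith

end OccupancyDifference

/-! ### Mixtures of state-action distributions and the policies they induce. -/

section Mixture

variable {S A : Type*}

/-- The weight at state `s` of the second policy in the policy of a mixture of two occupancy
measures with state marginals `a` and `b`. -/
def mixWeight (a b : S → ℝ) (α : ℝ) (s : S) : ℝ := α * b s / ((1 - α) * a s + α * b s)

/-- The policy of the mixture with weights `1 - α`, `α` of the state-action distributions
`a(s) π₀(a|s)` and `b(s) π₁(a|s)`. -/
def mixPolicy (a b : S → ℝ) (π₀ π₁ : PolicyVec S A) (α : ℝ) : PolicyVec S A :=
  WithLp.toLp 2 fun x => π₀ x + mixWeight a b α x.1 * (π₁ x - π₀ x)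

/-- The velocity of `mixPolicy` at `α = 0`. -/
def mixVelocity (a b : S → ℝ) (π₀ π₁ : PolicyVec S A) : PolicyVec S A :=
  WithLp.toLp 2 fun x => b x.1 / a x.1 * (π₁ x - π₀ x)

lemma mixMarginal_pos {a b : S → ℝ} (ha : ∀ s, 0 < a s) (hb : ∀ s, 0 < b s) {α : ℝ}
    (hα : α ∈ Set.Icc (0 : ℝ) 1) (s : S) : 0 < (1 - α) * a s + α * b s := by
  rcases hα.1.eq_or_lt with h | h
  · simpa [← h] using ha s
  · exact add_pos_of_nonneg_of_pos (mul_nonneg (sub_nonneg.2 hα.2) (ha s).le) (mul_pos h (hb s))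

lemma mixWeight_mem_Icc {a b : S → ℝ} (ha : ∀ s, 0 < a s) (hb : ∀ s, 0 < b s) {α : ℝ}
    (hα : α ∈ Set.Icc (0 : ℝ) 1) (s : S) : mixWeight a b α s ∈ Set.Icc (0 : ℝ) 1 := by
  have hpos := mixMarginal_pos ha hb hα s
  refine ⟨div_nonneg (mul_nonneg hα.1 (hb s).le) hpos.le, (div_le_one hpos).2 ?_⟩
  linarith [mul_nonneg (sub_nonneg.2 hα.2) (ha s).le]

lemma mixPolicy_zero (a b : S → ℝ) (π₀ π₁ : PolicyVec S A) : mixPolicy a b π₀ π₁ 0 = π₀ := by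
  ext x
  simp [mixPolicy, mixWeight]

/-- The mixture of the state-action distributions has `mixPolicy` as its policy. -/
lemma mixMarginal_mul_mixPolicy {a b : S → ℝ} (ha : ∀ s, 0 < a s) (hb : ∀ s, 0 < b s) {α : ℝ}
    (hα : α ∈ Set.Icc (0 : ℝ) 1) (π₀ π₁ : PolicyVec S A) (x : S × A) :
    ((1 - α) * a x.1 + α * b x.1) * mixPolicy a b π₀ π₁ α x =
      (1 - α) * (a x.1 * π₀ x) + α * (b x.1 * π₁ x) := by
  have hpos := mixMarginal_pos ha hb hα x.1
  simp only [mixPolicy, mixWeight]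
  field_simp
  ring

lemma policySpace_add_mul_mem [Fintype A] {π₀ π₁ : PolicyVec S A} (hπ₀ : π₀ ∈ policySpace S A)
    (hπ₁ : π₁ ∈ policySpace S A) {β : S → ℝ} (hβ : ∀ s, β s ∈ Set.Icc (0 : ℝ) 1) :
    (WithLp.toLp 2 fun x => π₀ x + β x.1 * (π₁ x - π₀ x) : PolicyVec S A) ∈ policySpace S A := by
  intro s
  convert (convex_stdSimplex ℝ A) (hπ₀ s) (hπ₁ s) (sub_nonneg.2 (hβ s).2) (hβ s).1
    (sub_add_cancel _ _) using 1
  ext a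
  simp
  ring

lemma mixPolicy_mem [Fintype A] {a b : S → ℝ} (ha : ∀ s, 0 < a s) (hb : ∀ s, 0 < b s) {α : ℝ}
    (hα : α ∈ Set.Icc (0 : ℝ) 1) {π₀ π₁ : PolicyVec S A} (hπ₀ : π₀ ∈ policySpace S A)
    (hπ₁ : π₁ ∈ policySpace S A) : mixPolicy a b π₀ π₁ α ∈ policySpace S A :=
  policySpace_add_mul_mem hπ₀ hπ₁ (mixWeight_mem_Icc ha hb hα)

/-- The velocity at a state is `π₁ - π₀` stretched by `b s / a s`, possibly leaving the policy
space. Since `b s ≤ 1` and `D ≤ a s`, the factor `D` brings the stretch back into the unit interval.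
This is why stationarity is assumed at level `D * ε`. -/
lemma add_smul_mixVelocity_mem [Fintype A] {a b : S → ℝ} {D : ℝ} (hD : 0 < D) (ha : ∀ s, D ≤ a s)
    (hb : ∀ s, b s ∈ Set.Icc (0 : ℝ) 1) {π₀ π₁ : PolicyVec S A} (hπ₀ : π₀ ∈ policySpace S A)
    (hπ₁ : π₁ ∈ policySpace S A) : π₀ + D • mixVelocity a b π₀ π₁ ∈ policySpace S A := by
  convert policySpace_add_mul_mem hπ₀ hπ₁ (β := fun s => D * (b s / a s)) (fun s => ?_) using 1
  · ext x
    simp [mixVelocity, mul_assoc]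
  · have hpos : 0 < a s := hD.trans_le (ha s)
    refine ⟨mul_nonneg hD.le (div_nonneg (hb s).1 hpos.le), ?_⟩
    rw [← mul_div_assoc, div_le_one hpos]
    exact (mul_le_of_le_one_right hD.le (hb s).2).trans (ha s)

lemma hasDerivAt_mixWeight {a b : S → ℝ} (s : S) (ha : 0 < a s) :
    HasDerivAt (fun α => mixWeight a b α s) (b s / a s) 0 := by
  have h1 : HasDerivAt (fun α : ℝ => α * b s) (b s) 0 := by
    simpa using (hasDerivAt_id (0 : ℝ)).mul_const (b s)
  have h2 : HasDerivAt (fun α : ℝ => (1 - α) * a s + α * b s) (-a s + b s) 0 := by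
    have h := ((hasDerivAt_id (0 : ℝ)).const_sub 1).mul_const (a s)
    exact (h.add h1).congr_deriv (by simp)
  refine (h1.div h2 (by simpa using ha.ne')).congr_deriv ?_
  simp
  field_simp

lemma hasDerivAt_mixPolicy [Fintype S] [Fintype A] {a b : S → ℝ} (ha : ∀ s, 0 < a s)
    (π₀ π₁ : PolicyVec S A) :
    HasDerivAt (mixPolicy a b π₀ π₁) (mixVelocity a b π₀ π₁) 0 := by
  have h : HasDerivAt (fun α x => π₀ x + mixWeight a b α x.1 * (π₁ x - π₀ x))
      (fun x : S × A => b x.1 / a x.1 * (π₁ x - π₀ x)) 0 :=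
    hasDerivAt_pi.2 fun x => ((hasDerivAt_mixWeight x.1 (ha x.1)).mul_const _).const_add _
  exact ((PiLp.continuousLinearEquiv 2 ℝ
    (fun _ : S × A => ℝ)).symm.toContinuousLinearMap.hasFDerivAt).comp_hasDerivAt 0 h

/-- In the application `C` is itself proportional to `‖π₁ - π₀‖`, so the velocity error is of second
order. -/
lemma norm_mixVelocity_sub_le [Fintype S] [Fintype A] {a b : S → ℝ} {D C : ℝ} (hD : 0 < D)
    (hC : 0 ≤ C) (ha : ∀ s, D ≤ a s) (hab : ∀ s, |b s - a s| ≤ C) (π₀ π₁ : PolicyVec S A) :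
    ‖mixVelocity a b π₀ π₁ - (π₁ - π₀)‖ ≤ C / D * ‖π₁ - π₀‖ := by
  refine norm_le_of_abs_le_mul (div_nonneg hC hD.le) fun x => ?_
  have hpos : 0 < a x.1 := hD.trans_le (ha x.1)
  have e : (mixVelocity a b π₀ π₁ - (π₁ - π₀)) x = (b x.1 - a x.1) / a x.1 * (π₁ - π₀) x := by
    simp only [mixVelocity, PiLp.sub_apply]
    field_simp
  rw [e, abs_mul, abs_div, abs_of_pos hpos]
  exact mul_le_mul_of_nonneg_right (div_le_div₀ hC (hab x.1) hD (ha x.1)) (abs_nonneg _)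

/-- Strong concavity of the entropy along mixtures of state-action distributions. -/
lemma le_mixture_entropy_gap [Fintype A] {a b : S → ℝ} (ha : ∀ s, 0 < a s) (hb : ∀ s, 0 < b s)
    {α : ℝ} (hα : α ∈ Set.Icc (0 : ℝ) 1) {π₀ π₁ : PolicyVec S A} (hπ₀ : π₀ ∈ policySpace S A)
    (hπ₁ : π₁ ∈ policySpace S A) (x : S × A) :
    α * (b x.1 * (1 - mixWeight a b α x.1) / 2 * (π₁ x - π₀ x) ^ 2) ≤
      (1 - α) * (a x.1 * π₀ x) * Real.log (π₀ x) + α * (b x.1 * π₁ x) * Real.log (π₁ x) -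
        ((1 - α) * a x.1 + α * b x.1) * mixPolicy a b π₀ π₁ α x *
          Real.log (mixPolicy a b π₀ π₁ α x) := by
  have hpos := mixMarginal_pos ha hb hα x.1
  have h := mul_le_mul_of_nonneg_left (mul_log_strong_convexity
    ⟨(hπ₀ x.1).1 x.2, policy_le_one hπ₀ x⟩ ⟨(hπ₁ x.1).1 x.2, policy_le_one hπ₁ x⟩
    (mixWeight_mem_Icc ha hb hα x.1) (z := mixPolicy a b π₀ π₁ α x) rfl) hpos.le
  -- The mass at the state times the weight of the second policy is the mass contributed by the
  -- second measure; this pulls out the factor `α` that is later divided away.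
  have e : ((1 - α) * a x.1 + α * b x.1) * mixWeight a b α x.1 = α * b x.1 := by
    rw [mixWeight, mul_div_cancel₀ _ hpos.ne']
  set m := (1 - α) * a x.1 + α * b x.1 with hm
  set β := mixWeight a b α x.1
  have e1 : m * ((1 - β) * (π₀ x * Real.log (π₀ x)) + β * (π₁ x * Real.log (π₁ x))) =
      (1 - α) * (a x.1 * π₀ x) * Real.log (π₀ x) + α * (b x.1 * π₁ x) * Real.log (π₁ x) := by
    linear_combination (π₁ x * Real.log (π₁ x) - π₀ x * Real.log (π₀ x)) * e +
      (π₀ x * Real.log (π₀ x)) * hm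
  have e2 : m * (β * (1 - β) / 2 * (π₁ x - π₀ x) ^ 2) =
      α * (b x.1 * (1 - β) / 2 * (π₁ x - π₀ x) ^ 2) := by
    linear_combination ((1 - β) / 2 * (π₁ x - π₀ x) ^ 2) * e
  linarith

end Mixture

/-! ### Geometry of the policy space: convexity, compactness, diameter. -/

section PolicySpace

variable {S A : Type*} [Fintype A]

lemma convex_policySpace : Convex ℝ (policySpace S A) := by
  intro π₀ h₀ π₁ h₁ a b ha hb hab s
  exact convex_stdSimplex ℝ A (h₀ s) (h₁ s) ha hb hab

lemma isCompact_policySpace [Fintype S] : IsCompact (policySpace S A) := by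
  refine Metric.isCompact_of_isClosed_isBounded ?_ ?_
  · have : policySpace S A = ⋂ s, (fun π : PolicyVec S A => fun a => π (s, a)) ⁻¹' stdSimplex ℝ A := by
      ext π
      simp [policySpace]
    rw [this]
    exact isClosed_iInter fun s => (isClosed_stdSimplex ℝ A).preimage (by fun_prop)
  · refine (Metric.isBounded_closedBall (x := (0 : PolicyVec S A))
      (r := √(∑ _x : S × A, 1))).subset fun π hπ => ?_
    rw [mem_closedBall_zero_iff, EuclideanSpace.norm_eq]
    refine Real.sqrt_le_sqrt (Finset.sum_le_sum fun x _ => ?_)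
    rw [Real.norm_of_nonneg ((hπ x.1).1 x.2)]
    exact pow_le_one₀ ((hπ x.1).1 x.2) (policy_le_one hπ x)

lemma policySpace_nonempty [Nonempty A] : (policySpace S A).Nonempty := by
  classical
  refine ⟨WithLp.toLp 2 fun x => if x.2 = Classical.arbitrary A then 1 else 0, fun s => ?_⟩
  refine ⟨fun a => ?_, by simp⟩
  dsimp only
  split_ifs <;> norm_num

/-- At each state the cross terms have a favourable sign, and a probability vector has squared norm
at most `1`, so every state contributes at most `2`. -/
lemma norm_sub_sq_le [Fintype S] {π₀ π₁ : PolicyVec S A} (h₀ : π₀ ∈ policySpace S A)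
    (h₁ : π₁ ∈ policySpace S A) : ‖π₁ - π₀‖ ^ 2 ≤ 2 * Fintype.card S := by
  rw [EuclideanSpace.norm_sq_eq, Fintype.sum_prod_type]
  have h : ∀ s, ∑ a, ‖(π₁ - π₀) (s, a)‖ ^ 2 ≤ 2 := fun s => by
    calc ∑ a, ‖(π₁ - π₀) (s, a)‖ ^ 2 ≤ ∑ a, (π₁ (s, a) ^ 2 + π₀ (s, a) ^ 2) := by
          refine Finset.sum_le_sum fun a _ => ?_
          rw [Real.norm_eq_abs, sq_abs, PiLp.sub_apply]
          nlinarith [mul_nonneg ((h₁ s).1 a) ((h₀ s).1 a)]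
      _ ≤ 2 := by
          rw [Finset.sum_add_distrib]
          linarith [sum_sq_le_one (h₁ s).1 (h₁ s).2, sum_sq_le_one (h₀ s).1 (h₀ s).2]
  calc ∑ s, ∑ a, ‖(π₁ - π₀) (s, a)‖ ^ 2 ≤ ∑ _s : S, (2 : ℝ) := Finset.sum_le_sum fun s _ => h s
    _ = 2 * Fintype.card S := by simp [mul_comm]

end PolicySpace

/-! ### Continuity of the performative value, existence of a maximizer, and the mixture identity. -/

namespace PerformativeMDP

variable {S A : Type*} [Fintype S] [Fintype A]

lemma Sensitive.continuousOn_p {M : PerformativeMDP S A} {εp εr : ℝ} (h : M.Sensitive εp εr) :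
    ContinuousOn M.p (policySpace S A) := by
  refine (LipschitzOnWith.of_dist_le_mul (K := εp.toNNReal) fun π hπ π' hπ' => ?_).continuousOn
  rw [dist_eq_norm, dist_eq_norm]
  exact ((h π' hπ' π hπ).1).trans
    (mul_le_mul_of_nonneg_right (Real.le_coe_toNNReal _) (norm_nonneg _))

lemma Sensitive.continuousOn_r {M : PerformativeMDP S A} {εp εr : ℝ} (h : M.Sensitive εp εr) :
    ContinuousOn M.r (policySpace S A) := by
  refine (LipschitzOnWith.of_dist_le_mul (K := εr.toNNReal) fun π hπ π' hπ' => ?_).continuousOn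
  rw [dist_eq_norm, dist_eq_norm]
  exact ((h π' hπ' π hπ).2).trans
    (mul_le_mul_of_nonneg_right (Real.le_coe_toNNReal _) (norm_nonneg _))

/-- The state value function of `π` in its own environment. -/
def perfStateValue (M : PerformativeMDP S A) (π : PolicyVec S A) : S → ℝ :=
  stateValue M.γ M.lam π (M.p π) (M.r π)

variable [Nonempty S] [Nonempty A] [MeasurableSpace S] [DiscreteMeasurableSpace S]
  [MeasurableSpace A] [DiscreteMeasurableSpace A]

/-- The state-action occupancy measure of `π` in its own environment. -/
def perfOccupancy (M : PerformativeMDP S A) (π : PolicyVec S A) : S × A → ℝ :=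
  occupancy M.γ M.ρ π (M.p π)

/-- The state occupancy measure of `π` in its own environment. -/
def perfStateOccupancy (M : PerformativeMDP S A) (π : PolicyVec S A) : S → ℝ :=
  stateOccupancy M.γ M.ρ π (M.p π)

lemma perfValue_eq (M : PerformativeMDP S A) {π : PolicyVec S A} (hπ : π ∈ policySpace S A) :
    M.perfValue π = ∑ s, M.ρ s * M.perfStateValue π s :=
  regValue_eq_sum_stateValue M.γ_pos.le M.γ_lt_one M.lam hπ (M.p_mem π hπ) M.ρ_mem (M.r π)

lemma continuousOn_perfValue {M : PerformativeMDP S A} {εp εr : ℝ} (h : M.Sensitive εp εr) :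
    ContinuousOn M.perfValue (policySpace S A) := by
  refine ContinuousOn.congr (f := fun π => ∑ s, M.ρ s * M.perfStateValue π s) ?_
    fun π hπ => M.perfValue_eq hπ
  exact continuousOn_finsetSum _ fun s _ => continuousOn_const.mul
    (continuousOn_stateValue M.γ_pos.le M.γ_lt_one M.p_mem h.continuousOn_p h.continuousOn_r s)

lemma exists_isMaxOn_perfValue {M : PerformativeMDP S A} {εp εr : ℝ} (h : M.Sensitive εp εr) :
    ∃ π ∈ policySpace S A, ∀ π' ∈ policySpace S A, M.perfValue π' ≤ M.perfValue π :=
  isCompact_policySpace.exists_isMaxOn policySpace_nonempty (continuousOn_perfValue h)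

lemma perfOccupancy_eq_mul (M : PerformativeMDP S A) {π : PolicyVec S A}
    (hπ : π ∈ policySpace S A) (x : S × A) :
    M.perfOccupancy π x = M.perfStateOccupancy π x.1 * π x :=
  occupancy_eq_mul M.γ_pos.le M.γ_lt_one hπ (M.p_mem π hπ) M.ρ_mem x

/-- Value of the mixture policy against the interpolation of the values: the gap consists of an
entropy term and of the effects of the shifts of the rewards and of the transition kernels. -/
lemma mixture_value_gap (M : PerformativeMDP S A) {π₀ π₁ : PolicyVec S A}
    (hπ₀ : π₀ ∈ policySpace S A) (hπ₁ : π₁ ∈ policySpace S A)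
    (h₀ : ∀ s, 0 < M.perfStateOccupancy π₀ s) (h₁ : ∀ s, 0 < M.perfStateOccupancy π₁ s)
    {α : ℝ} (hα : α ∈ Set.Icc (0 : ℝ) 1) {π : PolicyVec S A}
    (hπ : π = mixPolicy (M.perfStateOccupancy π₀) (M.perfStateOccupancy π₁) π₀ π₁ α) :
    (1 - M.γ) * (M.perfValue π - ((1 - α) * M.perfValue π₀ + α * M.perfValue π₁)) =
      M.lam * ∑ x : S × A, ((1 - α) * M.perfOccupancy π₀ x * Real.log (π₀ x) +
        α * M.perfOccupancy π₁ x * Real.log (π₁ x) -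
        ((1 - α) * M.perfStateOccupancy π₀ x.1 + α * M.perfStateOccupancy π₁ x.1) * π x *
          Real.log (π x)) +
      ∑ x : S × A, ((1 - α) * M.perfOccupancy π₀ x * (M.r π x - M.r π₀ x) +
        α * M.perfOccupancy π₁ x * (M.r π x - M.r π₁ x)) +
      M.γ * ∑ k : S × A × S, ((1 - α) * M.perfOccupancy π₀ (k.1, k.2.1) * (M.p π k - M.p π₀ k) +
        α * M.perfOccupancy π₁ (k.1, k.2.1) * (M.p π k - M.p π₁ k)) *
          M.perfStateValue π k.2.2 := by
  have hγ0 := M.γ_pos.le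
  have hγ1 := M.γ_lt_one
  have hπm : π ∈ policySpace S A := hπ ▸ mixPolicy_mem h₀ h₁ hα hπ₀ hπ₁
  set V := M.perfStateValue π with hV
  set d₀ := M.perfOccupancy π₀ with hd₀
  set d₁ := M.perfOccupancy π₁ with hd₁
  set m : S → ℝ := fun s => (1 - α) * M.perfStateOccupancy π₀ s + α * M.perfStateOccupancy π₁ s
    with hm
  have hd : ∀ x, m x.1 * π x = (1 - α) * d₀ x + α * d₁ x := fun x => by
    rw [hd₀, hd₁, M.perfOccupancy_eq_mul hπ₀, M.perfOccupancy_eq_mul hπ₁, hπ]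
    exact mixMarginal_mul_mixPolicy h₀ h₁ hα π₀ π₁ x
  -- The mixture satisfies the flow equation with each component transported by its own kernel, not
  -- by `M.p π`. This mismatch is the source of the kernel term in the identity.
  have hflow : ∀ s, m s = (1 - M.γ) * M.ρ s + M.γ * ∑ x : S × A,
      ((1 - α) * d₀ x * M.p π₀ (x.1, x.2, s) + α * d₁ x * M.p π₁ (x.1, x.2, s)) := fun s => by
    have f₀ : M.perfStateOccupancy π₀ s = _ :=
      stateOccupancy_flow hγ0 hγ1 hπ₀ (M.p_mem π₀ hπ₀) M.ρ_mem s
    have f₁ : M.perfStateOccupancy π₁ s = _ :=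
      stateOccupancy_flow hγ0 hγ1 hπ₁ (M.p_mem π₁ hπ₁) M.ρ_mem s
    change (1 - α) * M.perfStateOccupancy π₀ s + α * M.perfStateOccupancy π₁ s = _
    rw [f₀, f₁, Finset.sum_add_distrib]
    simp_rw [mul_assoc, ← Finset.mul_sum]
    simp only [hd₀, hd₁, perfOccupancy]
    ring
  -- The Bellman equation of `π` may be integrated against any distribution whose policy is `π`; the
  -- mixture need not be an occupancy measure.
  have hb := sum_mul_reward_eq hγ0 hγ1 hπm (M.p_mem π hπm) M.lam (M.r π)
    (d := fun x => m x.1 * π x) (dS := m) fun _ => rfl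
  have hv₀ : (1 - M.γ) * M.perfValue π₀ = ∑ x, d₀ x * (M.r π₀ x - M.lam * Real.log (π₀ x)) :=
    regValue_eq_sum_occupancy hγ0 hγ1 M.lam M.ρ π₀ (M.p π₀) (M.r π₀)
  have hv₁ : (1 - M.γ) * M.perfValue π₁ = ∑ x, d₁ x * (M.r π₁ x - M.lam * Real.log (π₁ x)) :=
    regValue_eq_sum_occupancy hγ0 hγ1 M.lam M.ρ π₁ (M.p π₁) (M.r π₁)
  have e1 : ∑ s, m s * V s = (1 - M.γ) * M.perfValue π + M.γ * ∑ k : S × A × S,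
      ((1 - α) * d₀ (k.1, k.2.1) * M.p π₀ k + α * d₁ (k.1, k.2.1) * M.p π₁ k) * V k.2.2 := by
    rw [M.perfValue_eq hπm]
    have e : ∀ s, m s * V s = (1 - M.γ) * (M.ρ s * V s) + M.γ * ∑ x : S × A,
        ((1 - α) * d₀ x * M.p π₀ (x.1, x.2, s) + α * d₁ x * M.p π₁ (x.1, x.2, s)) * V s := fun s => by
      rw [hflow, ← Finset.sum_mul]
      ring
    rw [Finset.sum_congr rfl fun s _ => e s, Finset.sum_add_distrib, ← Finset.mul_sum,
      ← Finset.mul_sum, Finset.sum_comm]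
    congr 2
    simp_rw [Fintype.sum_prod_type]
  have e2 : ∑ x : S × A, m x.1 * π x * ∑ s', M.p π (x.1, x.2, s') * V s' =
      ∑ k : S × A × S, ((1 - α) * d₀ (k.1, k.2.1) + α * d₁ (k.1, k.2.1)) * M.p π k * V k.2.2 := by
    simp_rw [hd, Finset.mul_sum, Fintype.sum_prod_type, mul_assoc]
  have e3 : ∑ k : S × A × S, ((1 - α) * d₀ (k.1, k.2.1) * (M.p π k - M.p π₀ k) +
      α * d₁ (k.1, k.2.1) * (M.p π k - M.p π₁ k)) * V k.2.2 =
      ∑ k : S × A × S, ((1 - α) * d₀ (k.1, k.2.1) + α * d₁ (k.1, k.2.1)) * M.p π k * V k.2.2 -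
      ∑ k : S × A × S,
        ((1 - α) * d₀ (k.1, k.2.1) * M.p π₀ k + α * d₁ (k.1, k.2.1) * M.p π₁ k) * V k.2.2 := by
    rw [← Finset.sum_sub_distrib]
    exact Finset.sum_congr rfl fun k _ => by ring
  have e4 : ∑ x, m x.1 * π x * (M.r π x - M.lam * Real.log (π x)) -
      ((1 - α) * ∑ x, d₀ x * (M.r π₀ x - M.lam * Real.log (π₀ x)) +
        α * ∑ x, d₁ x * (M.r π₁ x - M.lam * Real.log (π₁ x))) =
      M.lam * ∑ x : S × A, ((1 - α) * d₀ x * Real.log (π₀ x) + α * d₁ x * Real.log (π₁ x) -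
        m x.1 * π x * Real.log (π x)) +
      ∑ x : S × A, ((1 - α) * d₀ x * (M.r π x - M.r π₀ x) +
        α * d₁ x * (M.r π x - M.r π₁ x)) := by
    simp_rw [Finset.mul_sum]
    rw [← Finset.sum_add_distrib, ← Finset.sum_add_distrib, ← Finset.sum_sub_distrib]
    refine Finset.sum_congr rfl fun x _ => ?_
    linear_combination (M.r π x) * hd x
  rw [show stateValue M.γ M.lam π (M.p π) (M.r π) = V from rfl, e1, e2] at hb
  change _ = M.lam * ∑ x : S × A, ((1 - α) * d₀ x * Real.log (π₀ x) +
    α * d₁ x * Real.log (π₁ x) - m x.1 * π x * Real.log (π x)) + _ + _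
  rw [← e4, e3]
  linear_combination -hb - (1 - α) * hv₀ - α * hv₁

end PerformativeMDP

/-! ### Numerical estimates behind the constant `μ`. -/

lemma sum_sq_mul_stateFunction_le {S A : Type*} [Fintype S] [Fintype A] {d : S × A → ℝ} {V : S → ℝ}
    {B C : ℝ} (hd : ∑ x, d x ^ 2 ≤ B ^ 2) (hV0 : ∀ s, 0 ≤ V s) (hV : ∀ s, V s ≤ C) :
    ∑ k : S × A × S, (d (k.1, k.2.1) * V k.2.2) ^ 2 ≤ (√(Fintype.card S) * C * B) ^ 2 := by
  have h1 : ∑ s, V s ^ 2 ≤ Fintype.card S * C ^ 2 := by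
    calc ∑ s, V s ^ 2 ≤ ∑ _s : S, C ^ 2 :=
          Finset.sum_le_sum fun s _ => pow_le_pow_left₀ (hV0 s) (hV s) 2
      _ = _ := by simp
  have e : ∑ k : S × A × S, (d (k.1, k.2.1) * V k.2.2) ^ 2 = (∑ x, d x ^ 2) * ∑ s, V s ^ 2 := by
    simp_rw [Fintype.sum_prod_type, Finset.sum_mul, Finset.mul_sum, mul_pow]
  rw [e, mul_pow, mul_pow, Real.sq_sqrt (Nat.cast_nonneg _), mul_comm]
  exact mul_le_mul h1 hd (Finset.sum_nonneg fun _ _ => sq_nonneg _) (by positivity)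

/-- The comparison of the constants in the curvature bound, where `q`, `σ` and `L` stand for `√|A|`,
`√|S|` and `1 + lam * log |A|`. -/
lemma curvature_constant_le {γ lam D L q σ n εp εr Sp Sr : ℝ} (hγ0 : 0 < γ) (hγ1 : γ < 1)
    (hD0 : 0 < D) (hD1 : D ≤ 1) (hL : 0 ≤ L) (hq : 0 ≤ q) (hσ : 1 ≤ σ) (hn : n = σ ^ 2)
    (hεp : 0 < εp) (hεr : 0 < εr) (hSp : 0 < Sp) (hSr : 0 < Sr) :
    (1 - γ) * ((D * lam / (1 - γ) - 6 * γ * n * L / (D * (1 - γ) ^ 3) *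
        (εp * (q + γ * εp * σ) + Sp * (1 - γ)) -
        (Sr * (1 - γ) + 4 * εr * (q + εp * σ)) / (D ^ 2 * (1 - γ) ^ 2)) / 2) ≤
      lam * (D / 2) -
        (εr * (γ * (q + σ * εp) / (1 - γ) / D + (q + γ * σ * εp) / (1 - γ)) + Sr / 2) -
        γ * (εp * (σ * (L / (1 - γ)) *
          (γ * (q + σ * εp) / (1 - γ) / D + (q + γ * σ * εp) / (1 - γ))) +
          n * (L / (1 - γ)) * (Sp / 2)) := by
  obtain ⟨t, rfl⟩ : ∃ t, γ = 1 - t := ⟨1 - γ, by ring⟩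
  have ht : 0 < t := by linarith
  rw [sub_sub_cancel]
  set g := 1 - t with hg
  have hn0 : 0 ≤ n := hn ▸ sq_nonneg σ
  have hσn : σ ≤ n := by nlinarith
  set W := q + g * εp * σ with hW
  have hW0 : 0 ≤ W := by positivity
  set R := g * (q + σ * εp) / t / D + (q + g * σ * εp) / t with hR
  -- `R` adds the velocity error and the occupancy difference, per unit of `‖π₁ - π₀‖ ^ 2`. Over the
  -- common denominator `D * t` each is at most `W`, using `γ < 1` and `D ≤ 1`.
  have hR1 : R ≤ 2 * W / (D * t) := by
    have e : R = (g * (q + σ * εp) + D * W) / (D * t) := by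
      rw [hR, hW]
      field_simp
    rw [e]
    refine div_le_div_of_nonneg_right ?_ (by positivity)
    have h1 : g * q ≤ q := mul_le_of_le_one_left hq hγ1.le
    have h2 : D * W ≤ W := mul_le_of_le_one_left hW0 hD1
    linarith
  have a1 : εr * R ≤ 2 * εr * (q + εp * σ) / (D ^ 2 * t) := by
    refine (mul_le_mul_of_nonneg_left hR1 hεr.le).trans ?_
    rw [← mul_div_assoc]
    refine div_le_div₀ (by positivity) ?_ (by positivity) ?_
    · have : g * (εp * σ) ≤ εp * σ := mul_le_of_le_one_left (by positivity) hγ1.le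
      have : W ≤ q + εp * σ := by linarith
      nlinarith
    · refine mul_le_mul_of_nonneg_right ?_ ht.le
      nlinarith
  have a2 : Sr / 2 ≤ Sr / (2 * D ^ 2) := by
    refine div_le_div_of_nonneg_left hSr.le (by positivity) ?_
    nlinarith
  -- The estimate really gives `2 * σ`; it is rounded up to `3 * n` to match half of the coefficient
  -- `6 * n` in `μ`.
  have a3 : εp * (σ * (L / t) * R) ≤ 3 * n * L * (εp * W) / (D * t ^ 2) := by
    have h1 : εp * (σ * (L / t) * R) ≤ εp * (σ * (L / t) * (2 * W / (D * t))) := by gcongr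
    have h2 : εp * (σ * (L / t) * (2 * W / (D * t))) = 2 * σ * (L * (εp * W)) / (D * t ^ 2) := by
      field_simp
    rw [h2] at h1
    refine h1.trans (div_le_div_of_nonneg_right ?_ (by positivity))
    have h3 : 0 ≤ L * (εp * W) := by positivity
    have h4 : 2 * σ ≤ 3 * n := by linarith
    have := mul_le_mul_of_nonneg_right h4 h3
    linarith
  have a4 : n * (L / t) * (Sp / 2) ≤ 3 * n * L * Sp / (D * t) := by
    have e : n * (L / t) * (Sp / 2) = n * L * Sp / 2 / t := by field_simp
    rw [e]
    refine div_le_div₀ (by positivity) ?_ (by positivity) (mul_le_of_le_one_left ht.le hD1)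
    have : 0 ≤ n * L * Sp := by positivity
    linarith
  have e : t * ((D * lam / t - 6 * g * n * L / (D * t ^ 3) * (εp * W + Sp * t) -
      (Sr * t + 4 * εr * (q + εp * σ)) / (D ^ 2 * t ^ 2)) / 2) =
      lam * (D / 2) - (2 * εr * (q + εp * σ) / (D ^ 2 * t) + Sr / (2 * D ^ 2)) -
        g * (3 * n * L * (εp * W) / (D * t ^ 2) + 3 * n * L * Sp / (D * t)) := by
    field_simp
    ring
  rw [e]
  have := mul_le_mul_of_nonneg_left (add_le_add a3 a4) hγ0.le
  linarith

/-! ### The first-order bound along the mixture path, and its consequences. -/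

namespace PerformativeMDP

variable {S A : Type*} [Fintype S] [Fintype A] [Nonempty S] [Nonempty A]
  [MeasurableSpace S] [DiscreteMeasurableSpace S]
  [MeasurableSpace A] [DiscreteMeasurableSpace A]

lemma perfStateOccupancy_nonneg (M : PerformativeMDP S A) (π : PolicyVec S A) (s : S) :
    0 ≤ M.perfStateOccupancy π s :=
  stateOccupancy_nonneg M.γ_pos.le M.γ_lt_one _ _ _ s

lemma perfOccupancy_nonneg (M : PerformativeMDP S A) (π : PolicyVec S A) (x : S × A) :
    0 ≤ M.perfOccupancy π x :=
  occupancy_nonneg M.γ_pos.le M.γ_lt_one _ _ _ x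

lemma sum_perfOccupancy (M : PerformativeMDP S A) (π : PolicyVec S A) :
    ∑ x, M.perfOccupancy π x = 1 :=
  sum_occupancy M.γ_pos.le M.γ_lt_one _ _ _

lemma perfStateOccupancy_le_one (M : PerformativeMDP S A) (π : PolicyVec S A) (s : S) :
    M.perfStateOccupancy π s ≤ 1 := by
  have h : ∑ s, M.perfStateOccupancy π s = 1 := sum_stateOccupancy M.γ_pos.le M.γ_lt_one _ _ _
  rw [← h]
  exact Finset.single_le_sum (fun s _ => M.perfStateOccupancy_nonneg π s) (Finset.mem_univ s)

/-- The path of policies of the mixtures of the occupancy measures of `π₀` and `π₁`. -/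
def mixPath (M : PerformativeMDP S A) (π₀ π₁ : PolicyVec S A) : ℝ → PolicyVec S A :=
  mixPolicy (M.perfStateOccupancy π₀) (M.perfStateOccupancy π₁) π₀ π₁

/-- The initial velocity of `mixPath`. -/
def mixPathVelocity (M : PerformativeMDP S A) (π₀ π₁ : PolicyVec S A) : PolicyVec S A :=
  mixVelocity (M.perfStateOccupancy π₀) (M.perfStateOccupancy π₁) π₀ π₁

/-- A lower bound for the gap between the value along `mixPath` and the interpolation of the values,
divided by the time. -/
def mixGap (M : PerformativeMDP S A) (π₀ π₁ : PolicyVec S A) (α : ℝ) : ℝ :=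
  M.lam * ∑ x : S × A, M.perfStateOccupancy π₁ x.1 *
      (1 - mixWeight (M.perfStateOccupancy π₀) (M.perfStateOccupancy π₁) α x.1) / 2 *
      (π₁ x - π₀ x) ^ 2 +
    ∑ x : S × A, ((1 - α) * M.perfOccupancy π₀ x *
        ((M.r (M.mixPath π₀ π₁ α) x - M.r π₀ x) / α) +
      M.perfOccupancy π₁ x * (M.r (M.mixPath π₀ π₁ α) x - M.r π₁ x)) +
    M.γ * ∑ k : S × A × S, ((1 - α) * M.perfOccupancy π₀ (k.1, k.2.1) *
        ((M.p (M.mixPath π₀ π₁ α) k - M.p π₀ k) / α) +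
      M.perfOccupancy π₁ (k.1, k.2.1) * (M.p (M.mixPath π₀ π₁ α) k - M.p π₁ k)) *
        M.perfStateValue (M.mixPath π₀ π₁ α) k.2.2

/-- The limit of `mixGap` at time `0`, where `gr` and `gp` are the gradients of the rewards and the
transition probabilities at `π₀`. -/
def mixGapLimit (M : PerformativeMDP S A) (π₀ π₁ : PolicyVec S A) (gr : S × A → PolicyVec S A)
    (gp : S × A × S → PolicyVec S A) : ℝ :=
  M.lam * ∑ x : S × A, M.perfStateOccupancy π₁ x.1 / 2 * (π₁ x - π₀ x) ^ 2 +
    ∑ x : S × A, (M.perfOccupancy π₀ x * inner ℝ (gr x) (M.mixPathVelocity π₀ π₁) -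
      M.perfOccupancy π₁ x * (M.r π₁ x - M.r π₀ x)) +
    M.γ * ∑ k : S × A × S, (M.perfOccupancy π₀ (k.1, k.2.1) * M.perfStateValue π₀ k.2.2 *
        inner ℝ (gp k) (M.mixPathVelocity π₀ π₁) -
      M.perfOccupancy π₁ (k.1, k.2.1) * M.perfStateValue π₀ k.2.2 * (M.p π₁ k - M.p π₀ k))

lemma mixPath_zero (M : PerformativeMDP S A) (π₀ π₁ : PolicyVec S A) : M.mixPath π₀ π₁ 0 = π₀ :=
  mixPolicy_zero _ _ _ _

section

variable {M : PerformativeMDP S A} {π₀ π₁ : PolicyVec S A}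

lemma mapsTo_mixPath (hπ₀ : π₀ ∈ policySpace S A) (hπ₁ : π₁ ∈ policySpace S A)
    (h₀ : ∀ s, 0 < M.perfStateOccupancy π₀ s) (h₁ : ∀ s, 0 < M.perfStateOccupancy π₁ s) :
    Set.MapsTo (M.mixPath π₀ π₁) (Set.Icc 0 1) (policySpace S A) :=
  fun _ hα => mixPolicy_mem h₀ h₁ hα hπ₀ hπ₁

/-- `mixture_value_gap` with its entropy term replaced by the strong concavity bound, all divided by
`α`. The remaining logarithms disappear, so the limit `α → 0` exists even when `π₀` has zero
entries. -/
lemma mixGap_le (hπ₀ : π₀ ∈ policySpace S A) (hπ₁ : π₁ ∈ policySpace S A)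
    (h₀ : ∀ s, 0 < M.perfStateOccupancy π₀ s) (h₁ : ∀ s, 0 < M.perfStateOccupancy π₁ s)
    {α : ℝ} (hα : α ∈ Set.Ioc (0 : ℝ) 1) :
    M.mixGap π₀ π₁ α ≤ (1 - M.γ) * ((M.perfValue (M.mixPath π₀ π₁ α) - M.perfValue π₀) / α -
      (M.perfValue π₁ - M.perfValue π₀)) := by
  have hα' := Set.Ioc_subset_Icc_self hα
  have hgap := M.mixture_value_gap hπ₀ hπ₁ h₀ h₁ hα' (π := M.mixPath π₀ π₁ α) rfl
  have hent : α * ∑ x : S × A, M.perfStateOccupancy π₁ x.1 *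
      (1 - mixWeight (M.perfStateOccupancy π₀) (M.perfStateOccupancy π₁) α x.1) / 2 *
      (π₁ x - π₀ x) ^ 2 ≤ ∑ x : S × A, ((1 - α) * M.perfOccupancy π₀ x * Real.log (π₀ x) +
        α * M.perfOccupancy π₁ x * Real.log (π₁ x) -
        ((1 - α) * M.perfStateOccupancy π₀ x.1 + α * M.perfStateOccupancy π₁ x.1) *
          M.mixPath π₀ π₁ α x * Real.log (M.mixPath π₀ π₁ α x)) := by
    rw [Finset.mul_sum]
    refine Finset.sum_le_sum fun x _ => ?_
    rw [M.perfOccupancy_eq_mul hπ₀, M.perfOccupancy_eq_mul hπ₁]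
    exact le_mixture_entropy_gap h₀ h₁ hα' hπ₀ hπ₁ x
  have hlam := mul_le_mul_of_nonneg_left hent M.lam_nonneg
  have e1 : ∑ x : S × A, ((1 - α) * M.perfOccupancy π₀ x *
        (M.r (M.mixPath π₀ π₁ α) x - M.r π₀ x) +
        α * M.perfOccupancy π₁ x * (M.r (M.mixPath π₀ π₁ α) x - M.r π₁ x)) =
      α * ∑ x : S × A, ((1 - α) * M.perfOccupancy π₀ x *
        ((M.r (M.mixPath π₀ π₁ α) x - M.r π₀ x) / α) +
        M.perfOccupancy π₁ x * (M.r (M.mixPath π₀ π₁ α) x - M.r π₁ x)) := by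
    rw [Finset.mul_sum]
    refine Finset.sum_congr rfl fun x _ => ?_
    field_simp [hα.1.ne']
  have e2 : ∑ k : S × A × S, ((1 - α) * M.perfOccupancy π₀ (k.1, k.2.1) *
        (M.p (M.mixPath π₀ π₁ α) k - M.p π₀ k) +
        α * M.perfOccupancy π₁ (k.1, k.2.1) * (M.p (M.mixPath π₀ π₁ α) k - M.p π₁ k)) *
          M.perfStateValue (M.mixPath π₀ π₁ α) k.2.2 =
      α * ∑ k : S × A × S, ((1 - α) * M.perfOccupancy π₀ (k.1, k.2.1) *
        ((M.p (M.mixPath π₀ π₁ α) k - M.p π₀ k) / α) +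
        M.perfOccupancy π₁ (k.1, k.2.1) * (M.p (M.mixPath π₀ π₁ α) k - M.p π₁ k)) *
          M.perfStateValue (M.mixPath π₀ π₁ α) k.2.2 := by
    rw [Finset.mul_sum]
    refine Finset.sum_congr rfl fun k _ => ?_
    field_simp [hα.1.ne']
  rw [e1, e2] at hgap
  refine le_of_mul_le_mul_left ?_ hα.1
  have e3 : α * ((1 - M.γ) * ((M.perfValue (M.mixPath π₀ π₁ α) - M.perfValue π₀) / α -
      (M.perfValue π₁ - M.perfValue π₀))) = (1 - M.γ) * (M.perfValue (M.mixPath π₀ π₁ α) -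
      ((1 - α) * M.perfValue π₀ + α * M.perfValue π₁)) := by
    field_simp [hα.1.ne']
    ring
  rw [e3, hgap, mixGap]
  linarith

lemma tendsto_mixGap {εp εr : ℝ} (hsens : M.Sensitive εp εr)
    (hπ₀ : π₀ ∈ policySpace S A) (hπ₁ : π₁ ∈ policySpace S A)
    (h₀ : ∀ s, 0 < M.perfStateOccupancy π₀ s) (h₁ : ∀ s, 0 < M.perfStateOccupancy π₁ s)
    {gr : S × A → PolicyVec S A} {gp : S × A × S → PolicyVec S A}
    (hgr : ∀ x, HasGradientWithinAt (fun π => M.r π x) (gr x) (policySpace S A) π₀)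
    (hgp : ∀ k, HasGradientWithinAt (fun π => M.p π k) (gp k) (policySpace S A) π₀) :
    Tendsto (M.mixGap π₀ π₁) (𝓝[Set.Ioc 0 1] 0) (𝓝 (M.mixGapLimit π₀ π₁ gr gp)) := by
  have hmaps := mapsTo_mixPath hπ₀ hπ₁ h₀ h₁
  have hder : HasDerivAt (M.mixPath π₀ π₁) (M.mixPathVelocity π₀ π₁) 0 :=
    hasDerivAt_mixPolicy h₀ π₀ π₁
  -- Convergence must be within the policy space, since rewards, kernels and state values are
  -- controlled only there.
  have hpath : Tendsto (M.mixPath π₀ π₁) (𝓝[Set.Ioc 0 1] 0) (𝓝[policySpace S A] π₀) := by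
    refine tendsto_nhdsWithin_iff.2 ⟨?_, ?_⟩
    · have := hder.continuousAt.tendsto
      rw [mixPath_zero] at this
      exact this.mono_left nhdsWithin_le_nhds
    · filter_upwards [self_mem_nhdsWithin] with α hα using hmaps (Set.Ioc_subset_Icc_self hα)
  have hid : Tendsto (fun α : ℝ => α) (𝓝[Set.Ioc 0 1] 0) (𝓝 0) :=
    tendsto_id.mono_left nhdsWithin_le_nhds
  have hone : Tendsto (fun α : ℝ => 1 - α) (𝓝[Set.Ioc 0 1] 0) (𝓝 1) := by
    simpa using hid.const_sub 1
  have hweight : ∀ s, Tendsto (fun α => mixWeight (M.perfStateOccupancy π₀)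
      (M.perfStateOccupancy π₁) α s) (𝓝[Set.Ioc 0 1] 0) (𝓝 0) := fun s => by
    have := (hasDerivAt_mixWeight (b := M.perfStateOccupancy π₁) s (h₀ s)).continuousAt.tendsto
    simp only [mixWeight, zero_mul, zero_div] at this
    exact this.mono_left nhdsWithin_le_nhds
  have hV : ∀ s, Tendsto (fun α => M.perfStateValue (M.mixPath π₀ π₁ α) s) (𝓝[Set.Ioc 0 1] 0)
      (𝓝 (M.perfStateValue π₀ s)) := fun s =>
    (continuousOn_stateValue M.γ_pos.le M.γ_lt_one M.p_mem hsens.continuousOn_p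
      hsens.continuousOn_r s π₀ hπ₀).tendsto.comp hpath
  refine Tendsto.add (Tendsto.add ?_ ?_) ?_
  · refine Tendsto.const_mul _ (tendsto_finsetSum _ fun x _ => Tendsto.mul_const _ ?_)
    simpa using (((hweight x.1).const_sub 1).const_mul (M.perfStateOccupancy π₁ x.1)).div_const 2
  · refine tendsto_finsetSum _ fun x _ => ?_
    have l1 := tendsto_div_of_hasGradientWithinAt (hgr x) hder.hasDerivWithinAt
      (M.mixPath_zero π₀ π₁) hmaps
    have l2 := (hgr x).continuousWithinAt.tendsto.comp hpath
    have := ((hone.mul_const (M.perfOccupancy π₀ x)).mul l1).add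
      ((l2.sub_const (M.r π₁ x)).const_mul (M.perfOccupancy π₁ x))
    convert this using 2
    · rfl
    · ring
  · refine Tendsto.const_mul _ (tendsto_finsetSum _ fun k _ => ?_)
    have l1 := tendsto_div_of_hasGradientWithinAt (hgp k) hder.hasDerivWithinAt
      (M.mixPath_zero π₀ π₁) hmaps
    have l2 := (hgp k).continuousWithinAt.tendsto.comp hpath
    have := (((hone.mul_const (M.perfOccupancy π₀ (k.1, k.2.1))).mul l1).add
      ((l2.sub_const (M.p π₁ k)).const_mul (M.perfOccupancy π₁ (k.1, k.2.1)))).mul (hV k.2.2)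
    convert this using 2
    · rfl
    · ring

/-- The limiting gap dominates the quadratic term with the constant `μ`. -/
lemma mu_mul_le_mixGapLimit {εp εr Sp Sr D : ℝ} (hεp : 0 < εp) (hεr : 0 < εr) (hSp : 0 < Sp)
    (hSr : 0 < Sr) (hD : 0 < D) (hsens : M.Sensitive εp εr) (hocc : M.OccupancyBound D)
    (hπ₀ : π₀ ∈ policySpace S A) (hπ₁ : π₁ ∈ policySpace S A)
    {gr : S × A → PolicyVec S A → PolicyVec S A} {gp : S × A × S → PolicyVec S A → PolicyVec S A}
    (hgr : ∀ x, ∀ π ∈ policySpace S A,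
      HasGradientWithinAt (fun π => M.r π x) (gr x π) (policySpace S A) π)
    (hgrL : ∀ x, ∀ π ∈ policySpace S A, ∀ π' ∈ policySpace S A,
      ‖gr x π' - gr x π‖ ≤ Sr * ‖π' - π‖)
    (hgp : ∀ k, ∀ π ∈ policySpace S A,
      HasGradientWithinAt (fun π => M.p π k) (gp k π) (policySpace S A) π)
    (hgpL : ∀ k, ∀ π ∈ policySpace S A, ∀ π' ∈ policySpace S A,
      ‖gp k π' - gp k π‖ ≤ Sp * ‖π' - π‖) :
    (1 - M.γ) * (M.mu εp εr Sp Sr D / 2 * ‖π₁ - π₀‖ ^ 2) ≤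
      M.mixGapLimit π₀ π₁ (fun x => gr x π₀) (fun k => gp k π₀) := by
  have hγ0 := M.γ_pos
  have hγ1 := M.γ_lt_one
  have ht : 0 < 1 - M.γ := sub_pos.2 hγ1
  have ho₀ : ∀ s, D ≤ M.perfStateOccupancy π₀ s := hocc π₀ hπ₀ _ (M.p_mem π₀ hπ₀)
  have ho₁ : ∀ s, D ≤ M.perfStateOccupancy π₁ s := hocc π₁ hπ₁ _ (M.p_mem π₁ hπ₁)
  have hD1 : D ≤ 1 := (ho₀ (Classical.arbitrary S)).trans (M.perfStateOccupancy_le_one _ _)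
  set X := ‖π₁ - π₀‖ with hX
  have hX0 : 0 ≤ X := norm_nonneg _
  set q := √(Fintype.card A) with hq
  set σ := √(Fintype.card S) with hσ
  have hq0 : 0 ≤ q := Real.sqrt_nonneg _
  have hσ0 : 0 ≤ σ := Real.sqrt_nonneg _
  have hσ1 : 1 ≤ σ := Real.one_le_sqrt.2 (by exact_mod_cast Fintype.card_pos (α := S))
  have hσn : (Fintype.card S : ℝ) = σ ^ 2 := (Real.sq_sqrt (Nat.cast_nonneg _)).symm
  set L := 1 + M.lam * Real.log (Fintype.card A) with hL
  have hL0 : 0 ≤ L := add_nonneg zero_le_one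
    (mul_nonneg M.lam_nonneg (Real.log_natCast_nonneg _))
  -- `δS` and `δ` bound the `ℓ¹` distances of the state and of the state-action occupancies, after
  -- sensitivity replaces the kernel distance by `εp * X`. They are linked by `δ = δS + q * X`.
  set δS := M.γ * (q + σ * εp) / (1 - M.γ) * X with hδS
  set δ := (q + M.γ * σ * εp) / (1 - M.γ) * X with hδ
  have hδS0 : 0 ≤ δS := by positivity
  have hδ0 : 0 ≤ δ := by positivity
  have hsS : ∑ s, |M.perfStateOccupancy π₁ s - M.perfStateOccupancy π₀ s| ≤ δS := by
    refine (sum_abs_stateOccupancy_sub_le hγ0.le hγ1 M.ρ_mem hπ₀ hπ₁ (M.p_mem π₀ hπ₀)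
      (M.p_mem π₁ hπ₁)).trans ?_
    have h := mul_le_mul_of_nonneg_left (hsens π₀ hπ₀ π₁ hπ₁).1 hσ0
    have e : δS = M.γ * (q * X + σ * (εp * X)) / (1 - M.γ) := by
      rw [hδS]
      ring
    rw [e]
    gcongr
  have hsA : ∑ x, |M.perfOccupancy π₀ x - M.perfOccupancy π₁ x| ≤ δ := by
    have h := sum_abs_occupancy_sub_le hγ0.le hγ1 M.ρ_mem hπ₀ hπ₁ (M.p_mem π₀ hπ₀)
      (M.p_mem π₁ hπ₁)
    simp_rw [abs_sub_comm (M.perfOccupancy π₀ _)]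
    have e : δ = δS + q * X := by
      rw [hδ, hδS]
      field_simp
      ring
    rw [e]
    exact h.trans (add_le_add_left hsS _)
  have hvel : ‖M.mixPathVelocity π₀ π₁ - (π₁ - π₀)‖ ≤ δS / D * X :=
    norm_mixVelocity_sub_le hD hδS0 ho₀ (fun s => (Finset.single_le_sum
      (f := fun s => |M.perfStateOccupancy π₁ s - M.perfStateOccupancy π₀ s|)
      (fun _ _ => abs_nonneg _) (Finset.mem_univ s)).trans hsS) π₀ π₁
  have hfeas : π₀ + D • M.mixPathVelocity π₀ π₁ ∈ policySpace S A :=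
    add_smul_mixVelocity_mem hD ho₀
      (fun s => ⟨M.perfStateOccupancy_nonneg π₁ s, M.perfStateOccupancy_le_one π₁ s⟩) hπ₀ hπ₁
  have hsq₀ : ∑ x, M.perfOccupancy π₀ x ^ 2 ≤ 1 ^ 2 := by
    rw [one_pow]
    exact sum_sq_le_one (M.perfOccupancy_nonneg π₀) (M.sum_perfOccupancy π₀)
  have hsq := sum_sq_le_sq_of_sum_abs_le hsA
  have hV0 : ∀ s, 0 ≤ M.perfStateValue π₀ s :=
    stateValue_nonneg hγ0.le hγ1 M.lam_nonneg hπ₀ (M.p_mem π₀ hπ₀) (M.r_mem π₀ hπ₀)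
  have hV1 : ∀ s, M.perfStateValue π₀ s ≤ L / (1 - M.γ) :=
    stateValue_le hγ0.le hγ1 M.lam_nonneg hπ₀ (M.p_mem π₀ hπ₀) (M.r_mem π₀ hπ₀)
  have hVm : 0 ≤ L / (1 - M.γ) := div_nonneg hL0 ht.le
  have hent : D / 2 * X ^ 2 ≤
      ∑ x : S × A, M.perfStateOccupancy π₁ x.1 / 2 * (π₁ x - π₀ x) ^ 2 := by
    rw [hX, EuclideanSpace.norm_sq_eq, Finset.mul_sum]
    refine Finset.sum_le_sum fun x _ => ?_
    rw [Real.norm_eq_abs, sq_abs, PiLp.sub_apply]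
    exact mul_le_mul_of_nonneg_right (by linarith [ho₁ x.1]) (sq_nonneg _)
  have hrew := le_sum_weighted_variation convex_policySpace hεr.le hSr.le
    (fun π hπ π' hπ' => (hsens π hπ π' hπ').2) hgr hgrL hπ₀ hπ₁ hD hD1 hfeas
    (c₀ := M.perfOccupancy π₀) (c₁ := M.perfOccupancy π₁) zero_le_one hδ0
    (M.perfOccupancy_nonneg π₁) hsq₀ hsq (M.sum_perfOccupancy π₁).le
  -- The weights are occupancies times the state value of `π₀`: at `α = 0` the path is at `π₀`, so
  -- the same value function multiplies both kernel shifts. The feasible step is again `η = D`.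
  have hker := le_sum_weighted_variation convex_policySpace hεp.le hSp.le
    (fun π hπ π' hπ' => (hsens π hπ π' hπ').1) hgp hgpL hπ₀ hπ₁ hD hD1 hfeas
    (c₀ := fun k => M.perfOccupancy π₀ (k.1, k.2.1) * M.perfStateValue π₀ k.2.2)
    (c₁ := fun k => M.perfOccupancy π₁ (k.1, k.2.1) * M.perfStateValue π₀ k.2.2)
    (B₀ := σ * (L / (1 - M.γ)) * 1) (B := σ * (L / (1 - M.γ)) * δ)
    (B₁ := Fintype.card S * (L / (1 - M.γ)))
    (by positivity) (by positivity)
    (fun k => mul_nonneg (M.perfOccupancy_nonneg π₁ _) (hV0 _))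
    (sum_sq_mul_stateFunction_le hsq₀ hV0 hV1)
    (by
      simp_rw [← sub_mul]
      exact sum_sq_mul_stateFunction_le
        (d := fun x => M.perfOccupancy π₀ x - M.perfOccupancy π₁ x) hsq hV0 hV1)
    (by
      have e : ∑ k : S × A × S, M.perfOccupancy π₁ (k.1, k.2.1) * M.perfStateValue π₀ k.2.2 =
          (∑ x, M.perfOccupancy π₁ x) * ∑ s, M.perfStateValue π₀ s := by
        simp_rw [Fintype.sum_prod_type, Finset.sum_mul, Finset.mul_sum]
      rw [e, M.sum_perfOccupancy, one_mul]
      calc ∑ s, M.perfStateValue π₀ s ≤ ∑ _s : S, L / (1 - M.γ) :=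
            Finset.sum_le_sum fun s _ => hV1 s
        _ = _ := by simp)
  rw [mul_one] at hker
  have hconst := mul_le_mul_of_nonneg_right (curvature_constant_le (lam := M.lam) hγ0 hγ1 hD hD1
    hL0 hq0 hσ1 hσn hεp hεr hSp hSr) (sq_nonneg X)
  have b1 : εr * (1 * ‖M.mixPathVelocity π₀ π₁ - (π₁ - π₀)‖ + δ * X) + 1 * (Sr / 2 * X ^ 2) ≤
      (εr * (M.γ * (q + σ * εp) / (1 - M.γ) / D + (q + M.γ * σ * εp) / (1 - M.γ)) + Sr / 2) *
        X ^ 2 := by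
    have h := mul_le_mul_of_nonneg_left (add_le_add_left hvel (δ * X)) hεr.le
    have e : εr * (δS / D * X + δ * X) = εr * (M.γ * (q + σ * εp) / (1 - M.γ) / D +
        (q + M.γ * σ * εp) / (1 - M.γ)) * X ^ 2 := by
      rw [hδS, hδ]
      ring
    linarith
  have b2 : εp * (σ * (L / (1 - M.γ)) * ‖M.mixPathVelocity π₀ π₁ - (π₁ - π₀)‖ +
        σ * (L / (1 - M.γ)) * δ * X) +
        Fintype.card S * (L / (1 - M.γ)) * (Sp / 2 * X ^ 2) ≤
      (εp * (σ * (L / (1 - M.γ)) *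
          (M.γ * (q + σ * εp) / (1 - M.γ) / D + (q + M.γ * σ * εp) / (1 - M.γ))) +
        Fintype.card S * (L / (1 - M.γ)) * (Sp / 2)) * X ^ 2 := by
    have hB : 0 ≤ σ * (L / (1 - M.γ)) := by positivity
    have h := mul_le_mul_of_nonneg_left (mul_le_mul_of_nonneg_left
      (add_le_add_left hvel (δ * X)) hB) hεp.le
    have e : εp * (σ * (L / (1 - M.γ)) * (δS / D * X + δ * X)) = εp * (σ * (L / (1 - M.γ)) *
        (M.γ * (q + σ * εp) / (1 - M.γ) / D + (q + M.γ * σ * εp) / (1 - M.γ))) * X ^ 2 := by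
      rw [hδS, hδ]
      ring
    linarith
  have b3 := mul_le_mul_of_nonneg_left hent M.lam_nonneg
  have b4 := mul_le_mul_of_nonneg_left ((neg_le_neg b2).trans hker) hγ0.le
  have emu : M.mu εp εr Sp Sr D = D * M.lam / (1 - M.γ) -
      6 * M.γ * Fintype.card S * L / (D * (1 - M.γ) ^ 3) *
        (εp * (q + M.γ * εp * σ) + Sp * (1 - M.γ)) -
      (Sr * (1 - M.γ) + 4 * εr * (q + εp * σ)) / (D ^ 2 * (1 - M.γ) ^ 2) := rfl
  rw [← emu] at hconst
  rw [mixGapLimit]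
  linarith

/-- First-order lower bound for the performative value along `mixPath`. -/
lemma exists_first_order_lower_bound {εp εr Sp Sr D : ℝ} (hεp : 0 < εp) (hεr : 0 < εr)
    (hSp : 0 < Sp) (hSr : 0 < Sr) (hD : 0 < D) (hsens : M.Sensitive εp εr)
    (hsmooth : M.Smooth Sp Sr) (hocc : M.OccupancyBound D)
    (hπ₀ : π₀ ∈ policySpace S A) (hπ₁ : π₁ ∈ policySpace S A) :
    ∃ (Ψ : ℝ → ℝ) (l : ℝ), Tendsto Ψ (𝓝[Set.Ioc 0 1] 0) (𝓝 l) ∧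
      (∀ α ∈ Set.Ioc (0 : ℝ) 1,
        Ψ α ≤ (M.perfValue (M.mixPath π₀ π₁ α) - M.perfValue π₀) / α) ∧
      M.perfValue π₁ - M.perfValue π₀ + M.mu εp εr Sp Sr D / 2 * ‖π₁ - π₀‖ ^ 2 ≤ l := by
  have ht : 0 < 1 - M.γ := sub_pos.2 M.γ_lt_one
  have h₀ : ∀ s, 0 < M.perfStateOccupancy π₀ s := fun s =>
    hD.trans_le (hocc π₀ hπ₀ _ (M.p_mem π₀ hπ₀) s)
  have h₁ : ∀ s, 0 < M.perfStateOccupancy π₁ s := fun s =>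
    hD.trans_le (hocc π₁ hπ₁ _ (M.p_mem π₁ hπ₁) s)
  have hp : ∀ k : S × A × S, LipschitzSmooth (fun π => M.p π k) Sp := fun k =>
    hsmooth.1 k.1 k.2.1 k.2.2
  have hr : ∀ x : S × A, LipschitzSmooth (fun π => M.r π x) Sr := fun x => hsmooth.2 x.1 x.2
  choose gp hgp hgpL using hp
  choose gr hgr hgrL using hr
  refine ⟨fun α => M.perfValue π₁ - M.perfValue π₀ + (1 - M.γ)⁻¹ * M.mixGap π₀ π₁ α,
    M.perfValue π₁ - M.perfValue π₀ +
      (1 - M.γ)⁻¹ * M.mixGapLimit π₀ π₁ (fun x => gr x π₀) (fun k => gp k π₀), ?_, ?_, ?_⟩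
  · exact ((tendsto_mixGap hsens hπ₀ hπ₁ h₀ h₁ (fun x => hgr x π₀ hπ₀)
      (fun k => hgp k π₀ hπ₀)).const_mul _).const_add _
  · intro α hα
    have := (inv_mul_le_iff₀ ht).2 (mixGap_le hπ₀ hπ₁ h₀ h₁ hα)
    linarith
  · have := (le_inv_mul_iff₀ ht).2 (mu_mul_le_mixGapLimit hεp hεr hSp hSr hD hsens hocc hπ₀ hπ₁
      hgr hgrL hgp hgpL)
    linarith

/-- Gradient dominance: the suboptimality of a stationary policy. -/
lemma IsStationary.perfValue_sub_le {εp εr Sp Sr D : ℝ} (hεp : 0 < εp) (hεr : 0 < εr)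
    (hSp : 0 < Sp) (hSr : 0 < Sr) (hD : 0 < D) (hsens : M.Sensitive εp εr)
    (hsmooth : M.Smooth Sp Sr) (hocc : M.OccupancyBound D) {ε : ℝ}
    (hst : M.IsStationary (D * ε) π₀) (hπ₁ : π₁ ∈ policySpace S A) :
    M.perfValue π₁ - M.perfValue π₀ + M.mu εp εr Sp Sr D / 2 * ‖π₁ - π₀‖ ^ 2 ≤ ε := by
  obtain ⟨hπ₀, g, hg, hgle⟩ := hst
  have ho₀ : ∀ s, D ≤ M.perfStateOccupancy π₀ s := hocc π₀ hπ₀ _ (M.p_mem π₀ hπ₀)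
  have h₀ : ∀ s, 0 < M.perfStateOccupancy π₀ s := fun s => hD.trans_le (ho₀ s)
  have h₁ : ∀ s, 0 < M.perfStateOccupancy π₁ s := fun s =>
    hD.trans_le (hocc π₁ hπ₁ _ (M.p_mem π₁ hπ₁) s)
  obtain ⟨Ψ, l, hΨ, hle, hl⟩ :=
    exists_first_order_lower_bound hεp hεr hSp hSr hD hsens hsmooth hocc hπ₀ hπ₁
  have hder : HasDerivAt (M.mixPath π₀ π₁) (M.mixPathVelocity π₀ π₁) 0 :=
    hasDerivAt_mixPolicy h₀ π₀ π₁
  have hlim := tendsto_div_of_hasGradientWithinAt hg hder.hasDerivWithinAt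
    (M.mixPath_zero π₀ π₁) (mapsTo_mixPath hπ₀ hπ₁ h₀ h₁)
  have h1 : l ≤ inner ℝ g (M.mixPathVelocity π₀ π₁) :=
    le_of_tendsto_of_tendsto hΨ hlim (by
      filter_upwards [self_mem_nhdsWithin] with α hα using hle α hα)
  -- Testing stationarity with the policy `π₀ + D • v`, for `v` the initial velocity, gives `D * ⟨g,
  -- v⟩ ≤ D * ε`.
  have h2 := hgle _ (add_smul_mixVelocity_mem hD ho₀ (b := M.perfStateOccupancy π₁)
    (fun s => ⟨M.perfStateOccupancy_nonneg π₁ s, M.perfStateOccupancy_le_one π₁ s⟩) hπ₀ hπ₁)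
  rw [add_sub_cancel_left, real_inner_smul_right] at h2
  exact (hl.trans h1).trans (le_of_mul_le_mul_left h2 hD)

lemma IsPO.perfValue_le {ε : ℝ} {π : PolicyVec S A} (h : M.IsPO ε π) {π' : PolicyVec S A}
    (hπ' : π' ∈ policySpace S A) : M.perfValue π' ≤ M.perfValue π + ε := by
  obtain ⟨_, m, hm, hle⟩ := h
  linarith [hm.2 (Set.mem_image_of_mem _ hπ')]

/-- Quadratic growth at performatively optimal policies. -/
lemma IsPO.mu_mul_norm_sq_nonpos {εp εr Sp Sr D : ℝ} (hεp : 0 < εp) (hεr : 0 < εr)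
    (hSp : 0 < Sp) (hSr : 0 < Sr) (hD : 0 < D) (hsens : M.Sensitive εp εr)
    (hsmooth : M.Smooth Sp Sr) (hocc : M.OccupancyBound D) (hpo₀ : M.IsPO 0 π₀)
    (hpo₁ : M.IsPO 0 π₁) : M.mu εp εr Sp Sr D * ‖π₁ - π₀‖ ^ 2 ≤ 0 := by
  have hπ₀ := hpo₀.1
  have hπ₁ := hpo₁.1
  obtain ⟨Ψ, l, hΨ, hle, hl⟩ :=
    exists_first_order_lower_bound hεp hεr hSp hSr hD hsens hsmooth hocc hπ₀ hπ₁
  have h₀ : ∀ s, 0 < M.perfStateOccupancy π₀ s := fun s =>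
    hD.trans_le (hocc π₀ hπ₀ _ (M.p_mem π₀ hπ₀) s)
  have h₁ : ∀ s, 0 < M.perfStateOccupancy π₁ s := fun s =>
    hD.trans_le (hocc π₁ hπ₁ _ (M.p_mem π₁ hπ₁) s)
  -- Optimality of `π₀` makes every difference quotient nonpositive, so no differentiability of the
  -- performative value is needed.
  have hl0 : l ≤ 0 := le_of_tendsto hΨ (by
    filter_upwards [self_mem_nhdsWithin] with α hα
    refine (hle α hα).trans (div_nonpos_of_nonpos_of_nonneg ?_ hα.1.le)
    linarith [hpo₀.perfValue_le (mapsTo_mixPath hπ₀ hπ₁ h₀ h₁ (Set.Ioc_subset_Icc_self hα))])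
  linarith [hpo₁.perfValue_le hπ₀]

end

end PerformativeMDP

end PerformativeRL

end

/-! ### Conclusion: comparison with a global maximizer. -/

theorem corollary1 {S A : Type*} [Fintype S] [Fintype A] [Nonempty S] [Nonempty A]
    [MeasurableSpace S] [DiscreteMeasurableSpace S] [MeasurableSpace A] [DiscreteMeasurableSpace A]
    (M : PerformativeRL.PerformativeMDP S A) (εp εr Sp Sr D : ℝ)
    (hεp : 0 < εp) (hεr : 0 < εr) (hSp : 0 < Sp) (hSr : 0 < Sr) (hD : 0 < D)
    (hsens : M.Sensitive εp εr) (hsmooth : M.Smooth Sp Sr) (hocc : M.OccupancyBound D) :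
    (∀ ε : ℝ, 0 ≤ ε → ∀ π : PerformativeRL.PolicyVec S A, M.IsStationary (D * ε) π →
      M.IsPO (ε + |M.mu εp εr Sp Sr D| * Fintype.card S) π ∧
      (0 ≤ M.mu εp εr Sp Sr D → M.IsPO ε π)) ∧
    (0 < M.mu εp εr Sp Sr D → ∃! π : PerformativeRL.PolicyVec S A, M.IsPO 0 π) := by
  obtain ⟨πm, hπm, hmax⟩ := PerformativeRL.PerformativeMDP.exists_isMaxOn_perfValue hsens
  have hgreatest : IsGreatest (M.perfValue '' PerformativeRL.policySpace S A) (M.perfValue πm) :=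
    ⟨Set.mem_image_of_mem _ hπm, by
      rintro _ ⟨π', hπ', rfl⟩
      exact hmax π' hπ'⟩
  refine ⟨fun ε _ π hst => ?_, fun hμ => ?_⟩
  · have hle := hst.perfValue_sub_le hεp hεr hSp hSr hD hsens hsmooth hocc hπm
    have hn := PerformativeRL.norm_sub_sq_le hst.1 hπm
    refine ⟨⟨hst.1, _, hgreatest, ?_⟩, fun hμ => ⟨hst.1, _, hgreatest, ?_⟩⟩
    -- A negative `μ` costs at most `|μ| / 2` times the squared diameter bound `2|S|`, which is the
    -- extra term `|μ||S|`.
    · have h1 := mul_le_mul_of_nonneg_left hn (abs_nonneg (M.mu εp εr Sp Sr D))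
      have h2 := mul_le_mul_of_nonneg_right (neg_abs_le (M.mu εp εr Sp Sr D))
        (sq_nonneg ‖πm - π‖)
      linarith
    · have := mul_nonneg hμ (sq_nonneg ‖πm - π‖)
      linarith
  · have hpo : M.IsPO 0 πm := ⟨hπm, _, hgreatest, by simp⟩
    refine ⟨πm, hpo, fun π hπ => ?_⟩
    have h := PerformativeRL.PerformativeMDP.IsPO.mu_mul_norm_sq_nonpos hεp hεr hSp hSr hD hsens
      hsmooth hocc hπ hpo
    have h2 : ‖πm - π‖ ^ 2 ≤ 0 := nonpos_of_mul_nonpos_right h hμ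
    have h3 : ‖πm - π‖ = 0 := pow_eq_zero_iff two_ne_zero |>.1 (le_antisymm h2 (sq_nonneg _))
    exact (sub_eq_zero.1 (norm_eq_zero.1 h3)).symm
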